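/- Let $M$ be a smooth ($C^\infty$) paracompact Hausdorff manifold of finite dimension, $\pi:\mathcal TM\to M$ the bundle of its nonzero tangent vectors, and $\pi^{-1}(TM)$ the pullback of $TM$ to $\mathcal TM$; sections of $\pi^{-1}(TM)$ are called $\pi$-vector fields, and $\overline\eta(u)=u$ is the fundamental one. Let $\rho:T(\mathcal TM)\to\pi^{-1}(TM)$ be the map induced by $d\pi$, let $\gamma:\pi^{-1}(TM)\to T(\mathcal TM)$ be the vertical lift, and let $J=\gamma\circ\rho$; for a function $f$ put $d_Jf=df\circ J$. A Finsler structure on $M$ is a continuous function $L:TM\to\mathbb R$, smooth and positive on $\mathcal TM$, with $L(\lambda u)=\lambda L(u)$ for $\lambda>0$, such that, with $E=\frac12L^2$, the fibrewise Hessian $g$ of $E$ at every $u\in\mathcal TM$ is positive definite; $g$ is a metric on $\pi^{-1}(TM)$. The canonical spray $G$ of $L$ is the vector field on $\mathcal TM$ with $i_G\,dd_JE=-dE$, and the Barthel connection of $L$ is the vector $1$-form $\Gamma=[J,G]$, i.e. $\Gamma X=[JX,G]-J[X,G]$, with horizontal and vertical projectors $h=\frac12(I+\Gamma)$ and $v=\frac12(I-\Gamma)$.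 The Cartan connection $\nabla$ of $L$ is the unique linear connection on $\pi^{-1}(TM)$ which is regular (that is, $T_u(\mathcal TM)=\ker\rho_u\oplus\ker K_u$ for every $u$, where $K(X)=\nabla_X\overline\eta$; vectors in $\ker K$ are called horizontal) and metric ($\nabla g=0$), and whose torsion $\mathbf T(X,Y)=\nabla_X\rho Y-\nabla_Y\rho X-\rho[X,Y]$ vanishes on pairs of horizontal vectors and satisfies $g(\mathbf T(X,Y),\rho Z)=g(\mathbf T(X,Z),\rho Y)$ for $X$ vertical and $Y,Z$ horizontal. A smooth $\pi$-vector field $\overline\zeta$ is concurrent for $L$ if $\nabla_X\overline\zeta=-\rho X$ for all $X$. Theorem. Let $L$ and $\widetilde L$ be Finsler structures on $M$, let $\overline\zeta$ be a concurrent $\pi$-vector field for $L$, and suppose that $\widetilde L^2=L^2+B^2$ on $\mathcal TM$, where $B=g(\overline\zeta,\overline\eta)$. Put $p^2=g(\overline\zeta,\overline\zeta)$. Then the Barthel connections $\Gamma$ of $L$ and $\widetilde\Gamma$ of $\widetilde L$ satisfy, on $\mathcal TM$, $$\widetilde\Gamma=\Gamma+2\,\frac{d_JE}{1+p^2}\otimes\gamma\overline\zeta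 .$$ Equivalently, $\widetilde h=h-\mathcal L$ and $\widetilde v=v+\mathcal L$, where $\mathcal L=-\dfrac{d_JE}{1+p^2}\otimes\gamma\overline\zeta$. -/

import Mathlib

open Set Bundle VectorField
open scoped Manifold ContDiff Topology

noncomputable section

namespace Finsler

universe u v

variable {E : Type u} [NormedAddCommGroup E] [NormedSpace ℝ E]
  {M : Type v} [TopologicalSpace M] [ChartedSpace E M] [IsManifold 𝓘(ℝ, E) ∞ M]

/-! ### The tangent bundle, the double tangent bundle and the pullback bundle -/

variable (E M) in
/-- The total space `TM` of the tangent bundle of `M`. -/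
abbrev TM : Type (max u v) := TangentBundle 𝓘(ℝ, E) M

/-- The fibre `T_{π w} M` over `w` of the pullback bundle `π⁻¹(TM)`. -/
abbrev PiFib (w : TM E M) : Type u := TangentSpace 𝓘(ℝ, E) w.proj

/-- The tangent space `T_w (TM)` of the manifold `TM` at `w`. -/
abbrev TTan (w : TM E M) : Type u := TangentSpace (𝓘(ℝ, E).tangent) w

variable (E M) in
/-- The slit tangent bundle `𝒯M`: the open set of nonzero tangent vectors of `M`. Fields on `𝒯M`
are represented by fields on `TM` whose values on the zero section are irrelevant. -/
def slit : Set (TM E M) := {w | w.2 ≠ 0}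

variable (E M) in
/-- A (not necessarily smooth) vector field on `TM`. -/
abbrev VField : Type (max u v) := ∀ w : TM E M, TTan w

variable (E M) in
/-- A (not necessarily smooth) `π`-vector field, i.e. a section `w ↦ Y w ∈ T_{π w} M` of the
pullback `π⁻¹(TM)` of the tangent bundle by `π`. -/
abbrev PiField : Type (max u v) := ∀ w : TM E M, PiFib w

/-- A vector field on `TM`, seen as a map into the total space `TTM`. -/
def VField.toMap (X : VField E M) (w : TM E M) :
    TangentBundle (𝓘(ℝ, E).tangent) (TM E M) := ⟨w, X w⟩

/-- A `π`-vector field, seen as a map `TM → TM` over `M`. Since `π⁻¹(TM)` is the fibre product of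
`TM` with itself over `M`, its smoothness is the smoothness of this map. -/
def PiField.toMap (Y : PiField E M) (w : TM E M) : TM E M := ⟨w.proj, Y w⟩

/-- The vector field `X` is differentiable at `w`. -/
def VField.DiffAt (X : VField E M) (w : TM E M) : Prop :=
  MDifferentiableAt (𝓘(ℝ, E).tangent) (𝓘(ℝ, E).tangent.tangent) X.toMap w

/-- The `π`-vector field `Y` is differentiable at `w`. -/
def PiField.DiffAt (Y : PiField E M) (w : TM E M) : Prop :=
  MDifferentiableAt (𝓘(ℝ, E).tangent) (𝓘(ℝ, E).tangent) Y.toMap w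

/-- The vector field `X` is of class `C^∞` on `s`. -/
def VField.SmoothOn (X : VField E M) (s : Set (TM E M)) : Prop :=
  ContMDiffOn (𝓘(ℝ, E).tangent) (𝓘(ℝ, E).tangent.tangent) ∞ X.toMap s

/-- The `π`-vector field `Y` is of class `C^∞` on `s`. -/
def PiField.SmoothOn (Y : PiField E M) (s : Set (TM E M)) : Prop :=
  ContMDiffOn (𝓘(ℝ, E).tangent) (𝓘(ℝ, E).tangent) ∞ Y.toMap s

/-- The bundle morphism `ρ : T(TM) → π⁻¹(TM)`, which is `dπ` on each tangent space. -/
def rho (w : TM E M) : TTan w →L[ℝ] PiFib w :=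
  mfderiv (𝓘(ℝ, E).tangent) 𝓘(ℝ, E) (TotalSpace.proj : TM E M → M) w

/-- The bundle morphism `γ : π⁻¹(TM) → T(TM)`: on the fibre over `w` it is the natural isomorphism
of `T_{π w} M` with the tangent space at `w` of the fibre `T_{π w} M`, i.e. the derivative at `w` of
the inclusion of this fibre into `TM`. -/
def gam (w : TM E M) : PiFib w →L[ℝ] TTan w :=
  mfderiv 𝓘(ℝ, E) (𝓘(ℝ, E).tangent) (fun y : E => (⟨w.proj, y⟩ : TM E M)) w.2

/-- The natural almost tangent structure `J = γ ∘ ρ`. -/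
def J (w : TM E M) : TTan w →L[ℝ] TTan w := (gam w).comp (rho w)

/-- The fundamental `π`-vector field `η`. -/
def eta : PiField E M := fun w => w.2

/-- The vector field `J X`. -/
def JField (X : VField E M) : VField E M := fun w => J w (X w)

/-- The `π`-vector field `ρ X`. -/
def rhoField (X : VField E M) : PiField E M := fun w => rho w (X w)

/-- The Lie bracket of vector fields on `TM`. -/
def bracket (X Y : VField E M) : VField E M := mlieBracket (𝓘(ℝ, E).tangent) X Y

/-- The differential of a function on `TM`. -/
def dFun (f : TM E M → ℝ) (w : TM E M) : TTan w →L[ℝ] ℝ := mvfderiv (𝓘(ℝ, E).tangent) f w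

/-- The semibasic 1-form `d_J f = i_J df = df ∘ J`. -/
def dJ (f : TM E M → ℝ) (w : TM E M) : TTan w →L[ℝ] ℝ := (dFun f w).comp (J w)

/-- The exterior derivative of a 1-form `θ`, evaluated on vector fields:
`dθ(X, Y) = X(θ(Y)) - Y(θ(X)) - θ([X, Y])`. -/
def dOne (θ : ∀ w : TM E M, TTan w →L[ℝ] ℝ) (X Y : VField E M) (w : TM E M) : ℝ :=
  dFun (fun z => θ z (Y z)) w (X w) - dFun (fun z => θ z (X z)) w (Y w) - θ w (bracket X Y w)

/-! ### Finsler structures -/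

/-- The energy `½ L²`. -/
def energy (L : TM E M → ℝ) (w : TM E M) : ℝ := L w ^ 2 / 2

/-- The Finsler metric `g` defined by `L`, a bilinear form on the fibres of `π⁻¹(TM)`: at `w` it is
the second derivative at `w` of the restriction of the energy to the tangent space `T_{π w} M`. -/
def metric (L : TM E M → ℝ) (w : TM E M) (a b : PiFib w) : ℝ :=
  fderiv ℝ (fun z : E => fderiv ℝ (fun y : E => energy L (⟨w.proj, y⟩ : TM E M)) z)
    (w.2 : E) (a : E) (b : E)

/-- `L` is a Finsler structure on `M`. -/
structure IsFinsler (L : TM E M → ℝ) : Prop where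
  continuous : Continuous L
  smooth : ContMDiffOn (𝓘(ℝ, E).tangent) 𝓘(ℝ, ℝ) ∞ L (slit E M)
  pos : ∀ w ∈ slit E M, 0 < L w
  homogeneous : ∀ (w : TM E M) (c : ℝ), 0 < c → L (⟨w.proj, c • w.2⟩ : TM E M) = c * L w
  posDef : ∀ w ∈ slit E M, ∀ a : PiFib w, a ≠ 0 → 0 < metric L w a a

/-- `G` is the canonical spray of `L`: the vector field on `𝒯M` with `i_G Ω = -dE`, where
`E = ½ L²` and `Ω = d d_J E`. -/
structure IsCanonicalSpray (L : TM E M → ℝ) (G : VField E M) : Prop where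
  smooth : G.SmoothOn (slit E M)
  eq : ∀ w ∈ slit E M, ∀ X : VField E M, X.DiffAt w →
    dOne (dJ (energy L)) G X w = -dFun (energy L) w (X w)

/-- `Γ` is the Barthel connection of `L` on `𝒯M`: the vector 1-form `[J, G]`
(Frölicher–Nijenhuis bracket), `[J, G] X = [J X, G] - J [X, G]`, where `G` is the canonical
spray of `L`. -/
def IsBarthel (L : TM E M → ℝ) (Γ : ∀ w : TM E M, TTan w →L[ℝ] TTan w) : Prop :=
  ∃ G : VField E M, IsCanonicalSpray L G ∧
    ∀ w ∈ slit E M, ∀ X : VField E M, X.DiffAt w →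
      Γ w (X w) = bracket (JField X) G w - J w (bracket X G w)

/-- The horizontal projector `½ (I + Γ)` of a nonlinear connection `Γ`. -/
def hProj (Γ : ∀ w : TM E M, TTan w →L[ℝ] TTan w) (w : TM E M) : TTan w →L[ℝ] TTan w :=
  (1 / 2 : ℝ) • (ContinuousLinearMap.id ℝ (TTan w) + Γ w)

/-- The vertical projector `½ (I - Γ)` of a nonlinear connection `Γ`. -/
def vProj (Γ : ∀ w : TM E M, TTan w →L[ℝ] TTan w) (w : TM E M) : TTan w →L[ℝ] TTan w :=
  (1 / 2 : ℝ) • (ContinuousLinearMap.id ℝ (TTan w) - Γ w)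

/-! ### Linear connections on the pullback bundle -/

variable (E M) in
/-- A smooth linear connection on the bundle `π⁻¹(TM)` over `𝒯M`. `D Y w x` is `D_x Y` for
`x ∈ T_w (𝒯M)`. As `D Y` at `w` depends only on the 1-jet of `Y` at `w`, the rules are stated for all
sections that are differentiable at `w`. -/
structure PiConnection where
  /-- The covariant derivative. -/
  D : PiField E M → ∀ w : TM E M, TTan w →L[ℝ] PiFib w
  add : ∀ w ∈ slit E M, ∀ Y Z : PiField E M, Y.DiffAt w → Z.DiffAt w →
    D (fun z => Y z + Z z) w = D Y w + D Z w
  leibniz : ∀ w ∈ slit E M, ∀ (f : TM E M → ℝ) (Y : PiField E M),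
    MDifferentiableAt (𝓘(ℝ, E).tangent) 𝓘(ℝ, ℝ) f w → Y.DiffAt w →
    D (fun z => f z • Y z) w = f w • D Y w + (dFun f w).smulRight (Y w)
  smooth : ∀ s : Set (TM E M), IsOpen s → s ⊆ slit E M → ∀ (X : VField E M) (Y : PiField E M),
    X.SmoothOn s → Y.SmoothOn s → PiField.SmoothOn (fun w => D Y w (X w)) s

/-- The connection (deflection) map `K : X ↦ D_X η`. -/
def PiConnection.K (D : PiConnection E M) (w : TM E M) : TTan w →L[ℝ] PiFib w := D.D eta w

/-- The connection is regular: `T_w(𝒯M)` is the direct sum of the vertical space `ker ρ` and the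
horizontal space `ker K`. -/
def PiConnection.IsRegular (D : PiConnection E M) : Prop :=
  ∀ w ∈ slit E M, IsCompl (LinearMap.ker (rho w : TTan w →ₗ[ℝ] PiFib w))
    (LinearMap.ker (D.K w : TTan w →ₗ[ℝ] PiFib w))

/-- The classical torsion `𝐓(X, Y) = D_X ρY - D_Y ρX - ρ[X, Y]`. -/
def PiConnection.torsion (D : PiConnection E M) (X Y : VField E M) : PiField E M :=
  fun w => D.D (rhoField Y) w (X w) - D.D (rhoField X) w (Y w) - rho w (bracket X Y w)

/-- `D` is the Cartan connection of `L`: it is regular and metric, its (h)h-torsion vanishes, and its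
(h)hv-torsion `T` satisfies `g(T(X, Y), Z) = g(T(X, Z), Y)`. As the torsion is a tensor, these
conditions are stated at `w` with vector fields which are horizontal or vertical at `w`. -/
structure IsCartan (L : TM E M → ℝ) (D : PiConnection E M) : Prop where
  regular : D.IsRegular
  metric_compatible : ∀ w ∈ slit E M, ∀ Y Z : PiField E M, Y.DiffAt w → Z.DiffAt w → ∀ x : TTan w,
    dFun (fun z => metric L z (Y z) (Z z)) w x =
      metric L w (D.D Y w x) (Z w) + metric L w (Y w) (D.D Z w x)
  hh_torsion : ∀ w ∈ slit E M, ∀ X Y : VField E M, X.DiffAt w → Y.DiffAt w →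
    D.K w (X w) = 0 → D.K w (Y w) = 0 → D.torsion X Y w = 0
  hhv_torsion : ∀ w ∈ slit E M, ∀ X Y Z : VField E M, X.DiffAt w → Y.DiffAt w → Z.DiffAt w →
    rho w (X w) = 0 → D.K w (Y w) = 0 → D.K w (Z w) = 0 →
    metric L w (D.torsion X Y w) (rho w (Z w)) = metric L w (D.torsion X Z w) (rho w (Y w))

/-- `ζ` is a concurrent `π`-vector field of `L`: it is smooth on `𝒯M` and `∇ζ = -ρ`, where `∇` is the
Cartan connection of `L`. -/
def IsConcurrent (L : TM E M → ℝ) (ζ : PiField E M) : Prop :=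
  ζ.SmoothOn (slit E M) ∧ ∃ D : PiConnection E M, IsCartan L D ∧
    ∀ w ∈ slit E M, D.D ζ w = -rho w

/-- `L'` is obtained from `L` by the energy `β`-change with the `π`-vector field `ζ`:
`L'² = L² + B²` with `B = g(ζ, η)`. -/
def IsEnergyChange (L L' : TM E M → ℝ) (ζ : PiField E M) : Prop :=
  ∀ w ∈ slit E M, L' w ^ 2 = L w ^ 2 + metric L w (ζ w) (eta w) ^ 2

/-- The vector 1-form `ℒ = - (d_J E / (1 + p²)) ⊗ γ ζ`, where `p² = g(ζ, ζ)`. -/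
def changeForm (L : TM E M → ℝ) (ζ : PiField E M) (w : TM E M) : TTan w →L[ℝ] TTan w :=
  -((1 / (1 + metric L w (ζ w) (ζ w))) • dJ (energy L) w).smulRight (gam w (ζ w))

end Finsler

end

/-!
The function `B = g(ζ, η)` of a concurrent field `ζ` satisfies `d_J B = -½ dp²`, hence
`dd_J B = 0` and `dd_J (E + ½ B²) = dd_J E + dB ∧ d_J B`. As `dB(G) = -2E` and `dB(γζ) = p²`, the
canonical spray of `L'` is `G' = G + (2E / (1 + p²)) γζ`. With `C` the Cartan tensor, on a vertical
vector `c`, `dd_J B = 0` gives `g(∂_c ζ, ·) = -2 C(ζ, c, ·)`, whereas `∇ζ = -ρ` gives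
`g(∂_c ζ, ·) = -C(ζ, c, ·)`. So `ζ` is constant along the fibres, and so is `p²`; only `E` is
differentiated in the bracket of `J` with the extra term of `G'`, which is therefore
`(2 d_J E / (1 + p²)) ⊗ γζ`.
-/

noncomputable section

namespace Finsler

universe u v

section Calculus

variable {E : Type*} [NormedAddCommGroup E] [NormedSpace ℝ E]
  {F : Type*} [NormedAddCommGroup F] [NormedSpace ℝ F]

theorem differentiableAt_div {f g : E → ℝ} {z : E}
    (hf : DifferentiableAt ℝ f z) (hg : DifferentiableAt ℝ g z) (hz : g z ≠ 0) :
    DifferentiableAt ℝ (fun y => f y / g y) z := by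
  simp only [div_eq_mul_inv]
  exact hf.fun_mul (hg.fun_inv hz)

theorem fderiv_div_apply_of_fderiv_eq_zero {f g : E → ℝ} {z x : E}
    (hf : DifferentiableAt ℝ f z) (hg : DifferentiableAt ℝ g z) (hz : g z ≠ 0)
    (hx : fderiv ℝ g z x = 0) :
    fderiv ℝ (fun y => f y / g y) z x = fderiv ℝ f z x / g z := by
  have h : HasFDerivAt (fun y => f y * (g y)⁻¹) _ z :=
    hf.hasFDerivAt.mul ((hasDerivAt_inv hz).comp_hasFDerivAt z hg.hasFDerivAt)
  simp only [div_eq_mul_inv]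
  rw [h.fderiv]
  simp [hx, mul_comm]

/-- The vertical derivative of `f` at `z`, i.e. the derivative of `y ↦ f (z.1, y)` at `z.2`. In
coordinates `(position, velocity)` on `TM`, the form `d_J f` is `x ↦ vertDeriv f z x.1`. -/
def vertDeriv (f : E × E → F) (z : E × E) : E →L[ℝ] F :=
  (fderiv ℝ f z).comp (ContinuousLinearMap.inr ℝ E E)

theorem contDiffAt_vertDeriv {f : E × E → F} {z : E × E} {m n : WithTop ℕ∞}
    (hf : ContDiffAt ℝ n f z) (hmn : m + 1 ≤ n) : ContDiffAt ℝ m (vertDeriv f) z :=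
  ContDiffAt.clm_comp (f := fun _ => ContinuousLinearMap.inr ℝ E E) (hf.fderiv_right hmn)
    contDiffAt_const

theorem differentiableAt_vertDeriv {f : E × E → F} {z : E × E} (hf : ContDiffAt ℝ 2 f z) :
    DifferentiableAt ℝ (vertDeriv f) z :=
  (contDiffAt_vertDeriv (m := 1) hf (by norm_num)).differentiableAt one_ne_zero

theorem eventuallyEq_vertDeriv {f g : E × E → F} {z : E × E} (h : f =ᶠ[𝓝 z] g) :
    vertDeriv f =ᶠ[𝓝 z] vertDeriv g := by
  filter_upwards [h.fderiv (𝕜 := ℝ)] with y hy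
  rw [vertDeriv, vertDeriv, hy]

theorem fderiv_vertDeriv_apply {f : E × E → F} {z : E × E} (hf : ContDiffAt ℝ 2 f z)
    (x : E × E) (a : E) :
    fderiv ℝ (vertDeriv f) z x a = fderiv ℝ (fderiv ℝ f) z x (0, a) := by
  have hd : DifferentiableAt ℝ (fderiv ℝ f) z :=
    (hf.fderiv_right (m := 1) (by norm_num)).differentiableAt one_ne_zero
  have h := hd.hasFDerivAt.clm_comp
    (hasFDerivAt_const (ContinuousLinearMap.inr ℝ E E) z)
  have h' : HasFDerivAt (vertDeriv f) _ z := h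
  rw [h'.fderiv]
  simp

theorem vertDeriv_vertDeriv_comm {f : E × E → F} {z : E × E} (hf : ContDiffAt ℝ 2 f z)
    (a b : E) : vertDeriv (vertDeriv f) z a b = vertDeriv (vertDeriv f) z b a :=
  calc fderiv ℝ (vertDeriv f) z (0, a) b
      = fderiv ℝ (fderiv ℝ f) z (0, a) (0, b) := fderiv_vertDeriv_apply hf _ _
    _ = fderiv ℝ (fderiv ℝ f) z (0, b) (0, a) := hf.isSymmSndFDerivAt (by simp) _ _
    _ = fderiv ℝ (vertDeriv f) z (0, b) a := (fderiv_vertDeriv_apply hf _ _).symm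

theorem hasFDerivAt_comp_prodMk {f : E × E → F} {p y : E} {A : E →L[ℝ] E}
    (hf : DifferentiableAt ℝ f (p, A y)) :
    HasFDerivAt (fun y => f (p, A y)) ((vertDeriv f (p, A y)).comp A) y := by
  have hi : HasFDerivAt (fun y => (p, A y)) ((0 : E →L[ℝ] E).prod A) y :=
    (hasFDerivAt_const _ _).prodMk A.hasFDerivAt
  refine (hf.hasFDerivAt.comp y hi).congr_fderiv ?_
  ext a
  rfl

theorem fderiv_fderiv_comp_prodMk {f : E × E → F} {p y : E} {A : E →L[ℝ] E}
    (hf : ContDiffAt ℝ 2 f (p, A y)) (a b : E) :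
    fderiv ℝ (fun y => fderiv ℝ (fun y => f (p, A y)) y) y a b =
      vertDeriv (vertDeriv f) (p, A y) (A a) (A b) := by
  have hcont : ContinuousAt (fun y => (p, A y)) y := by fun_prop
  have h1 : (fun y => fderiv ℝ (fun y => f (p, A y)) y) =ᶠ[𝓝 y]
      fun y => (vertDeriv f (p, A y)).comp A := by
    filter_upwards [hcont.eventually ((hf.of_le one_le_two).eventually (by simp))] with y' hy'
    exact (hasFDerivAt_comp_prodMk (hy'.differentiableAt one_ne_zero)).fderiv
  have h2 : DifferentiableAt ℝ (vertDeriv f) (p, A y) := differentiableAt_vertDeriv hf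
  rw [h1.fderiv_eq, ((hasFDerivAt_comp_prodMk h2).clm_comp (hasFDerivAt_const A y)).fderiv]
  simp

theorem fderiv_bilinear_apply {c : E → F →L[ℝ] F →L[ℝ] ℝ} {V W : E → F} {z : E}
    (hc : DifferentiableAt ℝ c z) (hV : DifferentiableAt ℝ V z) (hW : DifferentiableAt ℝ W z)
    (x : E) :
    fderiv ℝ (fun y => c y (V y) (W y)) z x =
      fderiv ℝ c z x (V z) (W z) + c z (fderiv ℝ V z x) (W z) + c z (V z) (fderiv ℝ W z x) := by
  rw [((hc.hasFDerivAt.clm_apply hV.hasFDerivAt).clm_apply hW.hasFDerivAt).fderiv]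
  simp only [ContinuousLinearMap.flip_add, add_apply, ContinuousLinearMap.comp_apply,
    ContinuousLinearMap.flip_apply]
  ring

theorem fderiv_vertDeriv_vertDeriv_comm {q : E × E → ℝ} {z : E × E} (hq : ContDiffAt ℝ 3 q z)
    (x : E × E) (a b : E) :
    fderiv ℝ (vertDeriv (vertDeriv q)) z x a b = fderiv ℝ (vertDeriv (vertDeriv q)) z x b a := by
  have hv : ContDiffAt ℝ 2 (vertDeriv q) z := contDiffAt_vertDeriv hq (by norm_num)
  have hvv := differentiableAt_vertDeriv hv
  have hq2 : ContDiffAt ℝ 2 q z := hq.of_le (by norm_num)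
  have h1 : (fun y => vertDeriv (vertDeriv q) y a b) =ᶠ[𝓝 z]
      fun y => vertDeriv (vertDeriv q) y b a := by
    filter_upwards [hq2.eventually (by simp)] with y hy using vertDeriv_vertDeriv_comm hy a b
  have h2 := congrArg (fun A : (E × E) →L[ℝ] ℝ => A x) h1.fderiv_eq
  rw [fderiv_bilinear_apply hvv (differentiableAt_const a) (differentiableAt_const b),
    fderiv_bilinear_apply hvv (differentiableAt_const b) (differentiableAt_const a)] at h2
  simpa using h2

theorem vertical_bracket_add_smul {u : E × E → E × E} {f : E × E → ℝ} {Z : E × E → E} {z : E × E}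
    (hu : DifferentiableAt ℝ u z) (hf : DifferentiableAt ℝ f z) (hZ : DifferentiableAt ℝ Z z)
    (hZv : ∀ c : E, fderiv ℝ Z z (0, c) = 0) (x : E × E) :
    fderiv ℝ (fun y => u y + (0, f y • Z y)) z (0, x.1) -
        (0, (fderiv ℝ (fun y => u y + (0, f y • Z y)) z x).1) =
      fderiv ℝ u z (0, x.1) - (0, (fderiv ℝ u z x).1) + vertDeriv f z x.1 • (0, Z z) := by
  have h : fderiv ℝ (fun y => u y + (0, f y • Z y)) z = _ := (hu.hasFDerivAt.add
    ((hasFDerivAt_const (0 : E) z).prodMk (hf.hasFDerivAt.smul hZ.hasFDerivAt))).fderiv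
  rw [h]
  refine Prod.ext ?_ ?_
  · simp
  · simp [hZv, vertDeriv]
    abel

/-! ### Homogeneous functions -/

section Homogeneous

variable {q : E × E → ℝ} {z : E × E}

theorem vertDeriv_snd_of_homogeneous {f : E × E → ℝ} {n : ℕ} (hf : DifferentiableAt ℝ f z)
    (h : ∀ t : ℝ, 0 < t → f (z.1, t • z.2) = t ^ n * f z) :
    vertDeriv f z z.2 = n * f z := by
  have h1 : HasDerivAt (fun t : ℝ => (z.1, t • z.2)) (0, z.2) 1 := by
    simpa using (hasDerivAt_const (1 : ℝ) z.1).prodMk ((hasDerivAt_id (1 : ℝ)).smul_const z.2)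
  have h2 : HasDerivAt (fun t : ℝ => f (z.1, t • z.2)) (fderiv ℝ f z (0, z.2)) 1 :=
    HasFDerivAt.comp_hasDerivAt (l := f) 1 (by simpa using hf.hasFDerivAt) h1
  have h3 : (fun t : ℝ => f (z.1, t • z.2)) =ᶠ[𝓝 1] fun t => t ^ n * f z := by
    filter_upwards [lt_mem_nhds one_pos] with t ht using h t ht
  have h4 : HasDerivAt (fun t : ℝ => t ^ n * f z) (n * f z) 1 := by
    simpa using (hasDerivAt_pow n (1 : ℝ)).mul_const (f z)
  exact h2.unique (h4.congr_of_eventuallyEq h3)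

theorem fderiv_vertDeriv_snd (hq : ContDiffAt ℝ 2 q z)
    (heuler : ∀ᶠ y in 𝓝 z, vertDeriv q y y.2 = 2 * q y) (x : E × E) :
    fderiv ℝ (vertDeriv q) z x z.2 = 2 * fderiv ℝ q z x - vertDeriv q z x.2 := by
  have hv : DifferentiableAt ℝ (vertDeriv q) z := differentiableAt_vertDeriv hq
  have h1 : HasFDerivAt (fun y => vertDeriv q y y.2) _ z :=
    hv.hasFDerivAt.clm_apply hasFDerivAt_snd
  have h2 := (h1.congr_of_eventuallyEq (heuler.mono fun y hy => hy.symm)).unique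
    ((hq.differentiableAt two_ne_zero).hasFDerivAt.const_mul 2)
  have h3 := congrArg (fun A : (E × E) →L[ℝ] ℝ => A x) h2
  simp only [add_apply, ContinuousLinearMap.comp_apply, ContinuousLinearMap.coe_snd',
    ContinuousLinearMap.flip_apply, smul_apply, smul_eq_mul] at h3
  linarith

theorem vertDeriv_vertDeriv_snd (hq : ContDiffAt ℝ 2 q z)
    (heuler : ∀ᶠ y in 𝓝 z, vertDeriv q y y.2 = 2 * q y) (a : E) :
    vertDeriv (vertDeriv q) z a z.2 = vertDeriv q z a := by
  have h := fderiv_vertDeriv_snd hq heuler (0, a)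
  change fderiv ℝ (vertDeriv q) z (0, a) z.2 = fderiv ℝ q z (0, a)
  change _ = _ - fderiv ℝ q z (0, a) at h
  linarith

theorem fderiv_vertDeriv_vertDeriv_snd (hq : ContDiffAt ℝ 3 q z)
    (heuler : ∀ᶠ y in 𝓝 z, vertDeriv q y y.2 = 2 * q y) (a c : E) :
    fderiv ℝ (vertDeriv (vertDeriv q)) z (0, c) a z.2 = 0 := by
  have hv : ContDiffAt ℝ 2 (vertDeriv q) z := contDiffAt_vertDeriv hq (by norm_num)
  have hvv := differentiableAt_vertDeriv hv
  have hq2 : ContDiffAt ℝ 2 q z := hq.of_le (by norm_num)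
  have h1 : (fun y : E × E => vertDeriv (vertDeriv q) y a y.2) =ᶠ[𝓝 z]
      fun y => vertDeriv q y a := by
    filter_upwards [heuler.eventually_nhds, hq2.eventually (by simp)] with y h h'
    exact vertDeriv_vertDeriv_snd h' h a
  have h2 := congrArg (fun A : (E × E) →L[ℝ] ℝ => A (0, c)) h1.fderiv_eq
  rw [fderiv_bilinear_apply hvv (differentiableAt_const a) differentiableAt_snd, fderiv_snd,
    fderiv_clm_apply (hv.differentiableAt two_ne_zero) (differentiableAt_const a)] at h2
  simp only [fderiv_fun_const, Pi.zero_apply, zero_apply, map_zero, add_zero, zero_add,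
    ContinuousLinearMap.coe_snd', ContinuousLinearMap.comp_zero,
    ContinuousLinearMap.flip_apply] at h2
  have h3 := vertDeriv_vertDeriv_comm hq2 a c
  change _ = fderiv ℝ (vertDeriv q) z (0, c) a at h3
  linarith

end Homogeneous

/-! ### The form `dd_J q` in coordinates -/

/-- The coordinate expression of the 2-form `dd_J q` at `z`, evaluated on `x` and `y`. -/
def ddJ (q : E × E → ℝ) (z x y : E × E) : ℝ :=
  fderiv ℝ (vertDeriv q) z x y.1 - fderiv ℝ (vertDeriv q) z y x.1

section ddJ

variable {q B P : E × E → ℝ} {z : E × E}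

theorem ddJ_vertical (q : E × E → ℝ) (z : E × E) (a : E) (x : E × E) :
    ddJ q z (0, a) x = vertDeriv (vertDeriv q) z a x.1 := by
  simp [ddJ, vertDeriv]

theorem ddJ_add_smul_left (q : E × E → ℝ) (z x x' y : E × E) (t : ℝ) :
    ddJ q z (x + t • x') y = ddJ q z x y + t * ddJ q z x' y := by
  simp only [ddJ, map_add, map_smul, add_apply, smul_apply, smul_eq_mul, Prod.fst_add,
    Prod.smul_fst]
  ring

theorem eq_of_ddJ_eq (hdef : ∀ a, vertDeriv (vertDeriv q) z a a = 0 → a = 0) {v v' : E × E}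
    (h : ∀ x, ddJ q z v x = ddJ q z v' x) : v = v' := by
  have hu : ∀ x, ddJ q z (v + (-1 : ℝ) • v') x = 0 := fun x => by
    rw [ddJ_add_smul_left, h]
    ring
  rw [← sub_eq_zero, sub_eq_add_neg, ← neg_one_smul ℝ v']
  generalize v + (-1 : ℝ) • v' = u at hu ⊢
  obtain ⟨a, b⟩ := u
  have ha : a = 0 := hdef a (by simpa [ddJ, vertDeriv] using hu (0, a))
  subst ha
  rw [hdef b (by simpa only [ddJ_vertical] using hu (b, 0)), Prod.mk_zero_zero]

theorem ddJ_congr {q' : E × E → ℝ} (h : q =ᶠ[𝓝 z] q') (x y : E × E) :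
    ddJ q z x y = ddJ q' z x y := by
  rw [ddJ, ddJ, (eventuallyEq_vertDeriv h).fderiv_eq]

theorem ddJ_eq_zero {k : ℝ} (hP : ContDiffAt ℝ 2 P z) (hB : DifferentiableAt ℝ (vertDeriv B) z)
    (h : ∀ᶠ y in 𝓝 z, ∀ x : E × E, vertDeriv B y x.1 = k * fderiv ℝ P y x) (x y : E × E) :
    ddJ B z x y = 0 := by
  have hd : DifferentiableAt ℝ (fderiv ℝ P) z :=
    (hP.fderiv_right (m := 1) (by norm_num)).differentiableAt one_ne_zero
  have key : ∀ x y : E × E,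
      fderiv ℝ (vertDeriv B) z x y.1 = k * fderiv ℝ (fderiv ℝ P) z x y := fun x y => by
    have h1 : (fun u => vertDeriv B u y.1) =ᶠ[𝓝 z] fun u => k * fderiv ℝ P u y :=
      h.mono fun u hu => hu y
    have h2 := congrArg (fun A : (E × E) →L[ℝ] ℝ => A x) h1.fderiv_eq
    rw [fderiv_const_mul (hd.clm_apply (differentiableAt_const y)),
      fderiv_clm_apply hB (differentiableAt_const y.1),
      fderiv_clm_apply hd (differentiableAt_const y)] at h2
    simpa using h2
  rw [ddJ, key, key, hP.isSymmSndFDerivAt (by simp) x y, sub_self]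

theorem hasFDerivAt_add_sq_div_two (hq : DifferentiableAt ℝ q z) (hB : DifferentiableAt ℝ B z) :
    HasFDerivAt (fun y => q y + B y ^ 2 / 2) (fderiv ℝ q z + B z • fderiv ℝ B z) z := by
  have h := hq.hasFDerivAt.add ((hB.hasFDerivAt.pow 2).mul_const (2⁻¹ : ℝ))
  refine h.congr_fderiv (ContinuousLinearMap.ext fun x => ?_)
  simp only [Nat.add_one_sub_one, pow_one, nsmul_eq_mul, Nat.cast_ofNat, add_apply, smul_apply,
    smul_eq_mul, add_right_inj]
  ring

theorem ddJ_add_sq_div_two (hq : ContDiffAt ℝ 2 q z) (hB : ContDiffAt ℝ 2 B z) (x y : E × E) :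
    ddJ (fun y => q y + B y ^ 2 / 2) z x y = ddJ q z x y + fderiv ℝ B z x * vertDeriv B z y.1
      - fderiv ℝ B z y * vertDeriv B z x.1 + B z * ddJ B z x y := by
  have hev : vertDeriv (fun y => q y + B y ^ 2 / 2) =ᶠ[𝓝 z]
      fun y => vertDeriv q y + B y • vertDeriv B y := by
    filter_upwards [(hq.of_le one_le_two).eventually (by simp),
      (hB.of_le one_le_two).eventually (by simp)] with u hqu hBu
    ext a
    simp [vertDeriv, (hasFDerivAt_add_sq_div_two (hqu.differentiableAt one_ne_zero)
      (hBu.differentiableAt one_ne_zero)).fderiv]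
  have hvq : DifferentiableAt ℝ (vertDeriv q) z := differentiableAt_vertDeriv hq
  have hvB : DifferentiableAt ℝ (vertDeriv B) z := differentiableAt_vertDeriv hB
  have h : HasFDerivAt (fun y => vertDeriv q y + B y • vertDeriv B y) _ z :=
    hvq.hasFDerivAt.add ((hB.differentiableAt two_ne_zero).hasFDerivAt.smul hvB.hasFDerivAt)
  rw [ddJ, hev.fderiv_eq, h.fderiv]
  simp only [add_apply, smul_apply, ContinuousLinearMap.smulRight_apply, smul_eq_mul, ddJ]
  ring

end ddJ

end Calculus

variable {E : Type u} [NormedAddCommGroup E] [NormedSpace ℝ E]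
  {M : Type v} [TopologicalSpace M] [ChartedSpace E M] [IsManifold 𝓘(ℝ, E) ∞ M]

/-! ### Coordinates on the tangent bundle -/

/-- The chart of `TM` around `w₀` induced by the chart of `M` around the foot of `w₀`. -/
abbrev chart (w₀ : TM E M) : PartialEquiv (TM E M) (E × E) := extChartAt (𝓘(ℝ, E).tangent) w₀

/-- The derivative at `w` of the chart of `TM` around `w₀`. -/
def chartDeriv (w₀ w : TM E M) : TTan w →L[ℝ] E × E :=
  mfderiv (𝓘(ℝ, E).tangent) 𝓘(ℝ, E × E) (chart w₀) w

/-- The derivative at the foot of `w` of the chart of `M` around the foot of `w₀`. -/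
def baseChartDeriv (w₀ w : TM E M) : PiFib w →L[ℝ] E :=
  mfderiv 𝓘(ℝ, E) 𝓘(ℝ, E) (extChartAt 𝓘(ℝ, E) w₀.proj) w.proj

theorem mem_chart_source {w₀ w : TM E M} :
    w ∈ (chart w₀).source ↔ w.proj ∈ (chartAt E w₀.proj).source := by
  rw [extChartAt_source, TangentBundle.mem_chart_source_iff]

theorem trivializationAt_snd {F H N : Type*} [NormedAddCommGroup F] [NormedSpace ℝ F]
    [TopologicalSpace H] {I : ModelWithCorners ℝ F H} [TopologicalSpace N] [ChartedSpace H N]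
    [IsManifold I 1 N] {x : N} {w : TangentBundle I N} (h : w.proj ∈ (chartAt H x).source) :
    (trivializationAt F (TangentSpace I) x w).2 =
      mfderiv I 𝓘(ℝ, F) (extChartAt I x) w.proj w.2 := by
  have hbase : w.proj ∈ (trivializationAt F (TangentSpace I) x).baseSet := h
  have hcoe : (trivializationAt F (TangentSpace I) x).continuousLinearMapAt ℝ w.proj w.2 =
      (trivializationAt F (TangentSpace I) x w).2 := by
    rw [Bundle.Trivialization.continuousLinearMapAt_apply,
      Bundle.Trivialization.linearMapAt_apply, if_pos hbase]
  exact hcoe.symm.trans (congrArg (fun A : TangentSpace I w.proj →L[ℝ] F => A w.2)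
    (TangentBundle.continuousLinearMapAt_trivializationAt h))

theorem chart_apply {w₀ w : TM E M} (h : w ∈ (chart w₀).source) :
    chart w₀ w = (extChartAt 𝓘(ℝ, E) w₀.proj w.proj, baseChartDeriv w₀ w w.2) :=
  Prod.ext rfl (trivializationAt_snd (mem_chart_source.1 h))

theorem eventually_mem_chart_source {w₀ w : TM E M} (h : w ∈ (chart w₀).source) :
    ∀ᶠ w' in 𝓝 w, w' ∈ (chart w₀).source :=
  (isOpen_extChartAt_source w₀).mem_nhds h

theorem eventually_nhds_chart {w : TM E M} {p : E × E → Prop} :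
    (∀ᶠ z in 𝓝 (chart w w), p z) ↔ ∀ᶠ w' in 𝓝 w, p (chart w w') := by
  rw [← map_extChartAt_nhds_of_boundaryless, Filter.eventually_map]

theorem contMDiffAt_chart {w₀ w : TM E M} (h : w ∈ (chart w₀).source) :
    ContMDiffAt (𝓘(ℝ, E).tangent) 𝓘(ℝ, E × E) ∞ (chart w₀) w :=
  contMDiffAt_extChartAt' (by rwa [extChartAt_source] at h)

theorem contMDiffAt_chart_symm {w₀ w : TM E M} (h : w ∈ (chart w₀).source) :
    ContMDiffAt 𝓘(ℝ, E × E) (𝓘(ℝ, E).tangent) ∞ (chart w₀).symm (chart w₀ w) :=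
  (contMDiffOn_extChartAt_symm w₀).contMDiffAt
    ((isOpen_extChartAt_target w₀).mem_nhds ((chart w₀).map_source h))

theorem mdifferentiableAt_chart {w₀ w : TM E M} (h : w ∈ (chart w₀).source) :
    MDifferentiableAt (𝓘(ℝ, E).tangent) 𝓘(ℝ, E × E) (chart w₀) w :=
  (contMDiffAt_chart h).mdifferentiableAt (by simp)

theorem mdifferentiableAt_proj (w : TM E M) :
    MDifferentiableAt (𝓘(ℝ, E).tangent) 𝓘(ℝ, E) (TotalSpace.proj : TM E M → M) w :=
  (contMDiff_proj (TangentSpace 𝓘(ℝ, E)) (n := ∞)).contMDiffAt.mdifferentiableAt (by simp)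

theorem chartDeriv_self (w : TM E M) : chartDeriv w w = ContinuousLinearMap.id ℝ (E × E) := by
  unfold chartDeriv
  rw [mfderiv_extChartAt_self]
  rfl

theorem baseChartDeriv_self (w : TM E M) :
    baseChartDeriv w w = ContinuousLinearMap.id ℝ E := by
  unfold baseChartDeriv
  rw [mfderiv_extChartAt_self]
  rfl

theorem isInvertible_chartDeriv {w₀ w : TM E M} (h : w ∈ (chart w₀).source) :
    (chartDeriv w₀ w).IsInvertible :=
  isInvertible_mfderiv_extChartAt h

theorem isInvertible_baseChartDeriv {w₀ w : TM E M} (h : w ∈ (chart w₀).source) :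
    (baseChartDeriv w₀ w).IsInvertible :=
  isInvertible_mfderiv_extChartAt (by rw [extChartAt_source]; exact mem_chart_source.1 h)

theorem baseChartDeriv_rho {w₀ w : TM E M} (h : w ∈ (chart w₀).source) (x : TTan w) :
    baseChartDeriv w₀ w (rho w x) = (chartDeriv w₀ w x).1 := by
  have hproj := mfderiv_comp w (I' := 𝓘(ℝ, E)) (I'' := 𝓘(ℝ, E))
    (mdifferentiableAt_extChartAt (mem_chart_source.1 h)) (mdifferentiableAt_proj w)
  have hfst : mfderiv (𝓘(ℝ, E).tangent) 𝓘(ℝ, E) ((Prod.fst : E × E → E) ∘ chart w₀) w =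
      (ContinuousLinearMap.fst ℝ E E).comp (chartDeriv w₀ w) := by
    refine (mfderiv_comp w (I' := 𝓘(ℝ, E × E)) ?_ (mdifferentiableAt_chart h)).trans ?_
    · exact differentiableAt_fst.mdifferentiableAt
    · rw [mfderiv_eq_fderiv, fderiv_fst]
      rfl
  have heq : (extChartAt 𝓘(ℝ, E) w₀.proj) ∘ (TotalSpace.proj : TM E M → M) =ᶠ[𝓝 w]
      (Prod.fst : E × E → E) ∘ chart w₀ := by
    filter_upwards [eventually_mem_chart_source h] with w' hw'
    simp only [Function.comp_apply, chart_apply hw']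
  rw [heq.mfderiv_eq, hfst] at hproj
  exact congrArg (fun A : (E × E) →L[ℝ] E => A x) hproj.symm

theorem contMDiff_fibreInclusion (x : M) :
    ContMDiff 𝓘(ℝ, E) (𝓘(ℝ, E).tangent) ∞ (fun y : E => (⟨x, y⟩ : TM E M)) := by
  intro y
  refine contMDiffAt_totalSpace.2 ⟨contMDiffAt_const, ?_⟩
  have h : (fun y : E => (trivializationAt E (TangentSpace 𝓘(ℝ, E)) x (⟨x, y⟩ : TM E M)).2) =
      (mfderiv 𝓘(ℝ, E) 𝓘(ℝ, E) (extChartAt 𝓘(ℝ, E) x) x : E →L[ℝ] E) := by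
    ext1 y
    exact trivializationAt_snd (w := (⟨x, y⟩ : TM E M)) (_root_.mem_chart_source E x)
  change ContMDiffAt _ _ _
    (fun y : E => (trivializationAt E (TangentSpace 𝓘(ℝ, E)) x (⟨x, y⟩ : TM E M)).2) y
  rw [h]
  exact (ContinuousLinearMap.contDiff (𝕜 := ℝ) (E := E) (F := E) _).contMDiff y

theorem chartDeriv_gam {w₀ w : TM E M} (h : w ∈ (chart w₀).source) (a : PiFib w) :
    chartDeriv w₀ w (gam w a) = (0, baseChartDeriv w₀ w a) := by
  have hcomp := mfderiv_comp (I := 𝓘(ℝ, E)) (f := fun y : E => (⟨w.proj, y⟩ : TM E M))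
    (w.2 : E) (mdifferentiableAt_chart h)
    ((contMDiff_fibreInclusion w.proj _).mdifferentiableAt (by simp))
  have hfibre : chart w₀ ∘ (fun y : E => (⟨w.proj, y⟩ : TM E M)) =
      fun y : E => (extChartAt 𝓘(ℝ, E) w₀.proj w.proj, (baseChartDeriv w₀ w : E →L[ℝ] E) y) := by
    ext1 y
    exact chart_apply (mem_chart_source.2 (mem_chart_source.1 h))
  have hderiv : HasFDerivAt
      (fun y : E => (extChartAt 𝓘(ℝ, E) w₀.proj w.proj, (baseChartDeriv w₀ w : E →L[ℝ] E) y))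
      ((0 : E →L[ℝ] E).prod (baseChartDeriv w₀ w : E →L[ℝ] E)) (w.2 : E) :=
    (hasFDerivAt_const _ _).prodMk (baseChartDeriv w₀ w : E →L[ℝ] E).hasFDerivAt
  rw [hfibre] at hcomp
  exact (congrArg (fun A : E →L[ℝ] E × E => A a)
    (hderiv.hasMFDerivAt.mfderiv.symm.trans hcomp)).symm

theorem chartDeriv_J {w₀ w : TM E M} (h : w ∈ (chart w₀).source) (x : TTan w) :
    chartDeriv w₀ w (J w x) = (0, (chartDeriv w₀ w x).1) :=
  (chartDeriv_gam h (rho w x)).trans (by rw [baseChartDeriv_rho h])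

theorem rho_apply (w : TM E M) (x : E × E) : rho w x = x.1 := by
  have h := baseChartDeriv_rho (mem_extChartAt_source (I := 𝓘(ℝ, E).tangent) w) x
  rw [chartDeriv_self, baseChartDeriv_self] at h
  exact h

theorem gam_apply (w : TM E M) (a : E) : gam w a = ((0, a) : E × E) := by
  have h := chartDeriv_gam (mem_extChartAt_source (I := 𝓘(ℝ, E).tangent) w) a
  rw [chartDeriv_self, baseChartDeriv_self] at h
  exact h

theorem J_apply (w : TM E M) (x : E × E) : J w x = ((0, x.1) : E × E) :=
  (gam_apply w (rho w x)).trans (congrArg (fun a : E => ((0, a) : E × E)) (rho_apply w x))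

theorem chart_mem_slit_iff {w₀ w : TM E M} (h : w ∈ (chart w₀).source) :
    (chart w₀ w).2 ≠ 0 ↔ w ∈ slit E M := by
  obtain ⟨A, hA⟩ := isInvertible_baseChartDeriv h
  rw [chart_apply h, ← hA]
  exact not_congr (map_eq_zero_iff A A.injective)

theorem chart_self_snd (w : TM E M) : (chart w w).2 = w.2 := by
  rw [chart_apply (mem_extChartAt_source w), baseChartDeriv_self]
  rfl

theorem slit_mem_nhds {w : TM E M} (hw : w ∈ slit E M) : slit E M ∈ 𝓝 w := by
  have h := mem_extChartAt_source (I := 𝓘(ℝ, E).tangent) w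
  have hcont : ContinuousAt (fun w' => (chart w w').2) w :=
    continuousAt_snd.comp (contMDiffAt_chart h).continuousAt
  filter_upwards [eventually_mem_chart_source h,
    hcont.eventually_ne ((chart_mem_slit_iff h).2 hw)] with w' h1 h2
  exact (chart_mem_slit_iff h1).1 h2

/-! ### Coordinate expressions -/

/-- The coordinate expression of a vector field on `TM` in the chart around `w₀`. -/
def VField.coord (w₀ : TM E M) (X : VField E M) (z : E × E) : E × E :=
  chartDeriv w₀ ((chart w₀).symm z) (X ((chart w₀).symm z))

/-- The coordinate expression of a `π`-vector field in the chart around `w₀`. -/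
def PiField.coord (w₀ : TM E M) (Y : PiField E M) (z : E × E) : E :=
  baseChartDeriv w₀ ((chart w₀).symm z) (Y ((chart w₀).symm z))

/-- The coordinate expression of a function on `TM` in the chart around `w₀`. -/
def coordFun {F : Type*} (w₀ : TM E M) (f : TM E M → F) (z : E × E) : F := f ((chart w₀).symm z)

/-- The vector field on `TM` with constant coordinates `c` in the chart around `w₀`. -/
def constVField (w₀ : TM E M) (c : E × E) : VField E M := fun w => (chartDeriv w₀ w).inverse c

/-- The `π`-vector field with constant coordinates `a` in the chart around `w₀`. -/
def constPiField (w₀ : TM E M) (a : E) : PiField E M := fun w => (baseChartDeriv w₀ w).inverse a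

section Coord

variable {w₀ w : TM E M}

theorem coordFun_chart {F : Type*} (f : TM E M → F) (h : w ∈ (chart w₀).source) :
    coordFun w₀ f (chart w₀ w) = f w := by
  rw [coordFun, (chart w₀).left_inv h]

theorem VField.coord_chart (X : VField E M) (h : w ∈ (chart w₀).source) :
    X.coord w₀ (chart w₀ w) = chartDeriv w₀ w (X w) := by
  rw [VField.coord, (chart w₀).left_inv h]

theorem PiField.coord_chart (Y : PiField E M) (h : w ∈ (chart w₀).source) :
    Y.coord w₀ (chart w₀ w) = baseChartDeriv w₀ w (Y w) := by
  rw [PiField.coord, (chart w₀).left_inv h]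

theorem VField.coord_self (X : VField E M) (w : TM E M) : X.coord w (chart w w) = X w := by
  rw [X.coord_chart (mem_extChartAt_source w), chartDeriv_self]
  rfl

theorem PiField.coord_self (Y : PiField E M) (w : TM E M) : Y.coord w (chart w w) = Y w := by
  rw [Y.coord_chart (mem_extChartAt_source w), baseChartDeriv_self]
  rfl

theorem eventuallyEq_coord {F : Type*} {f g : E × E → F} {w : TM E M}
    (h : ∀ w' ∈ (chart w).source, f (chart w w') = g (chart w w')) : f =ᶠ[𝓝 (chart w w)] g :=
  eventually_nhds_chart.2 ((eventually_mem_chart_source (mem_extChartAt_source w)).mono h)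

theorem eventuallyEq_coord_constVField (w : TM E M) (c : E × E) :
    (constVField w c).coord w =ᶠ[𝓝 (chart w w)] fun _ => c :=
  eventuallyEq_coord fun _ h =>
    (VField.coord_chart _ h).trans ((isInvertible_chartDeriv h).self_apply_inverse c)

theorem eventuallyEq_coord_constPiField (w : TM E M) (a : E) :
    (constPiField w a).coord w =ᶠ[𝓝 (chart w w)] fun _ => a :=
  eventuallyEq_coord fun _ h =>
    (PiField.coord_chart _ h).trans ((isInvertible_baseChartDeriv h).self_apply_inverse a)

theorem eventuallyEq_coord_eta (w : TM E M) :
    (eta : PiField E M).coord w =ᶠ[𝓝 (chart w w)] Prod.snd :=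
  eventuallyEq_coord fun _ h => (PiField.coord_chart _ h).trans (by rw [chart_apply h]; rfl)

theorem eventuallyEq_coord_rhoField (X : VField E M) (w : TM E M) :
    (rhoField X).coord w =ᶠ[𝓝 (chart w w)] fun z => (X.coord w z).1 :=
  eventuallyEq_coord fun _ h => by
    rw [PiField.coord_chart _ h, X.coord_chart h]
    exact baseChartDeriv_rho h _

theorem eventuallyEq_coord_JField (X : VField E M) (w : TM E M) :
    (JField X).coord w =ᶠ[𝓝 (chart w w)] fun z => (0, (X.coord w z).1) :=
  eventuallyEq_coord fun _ h => by
    rw [VField.coord_chart _ h, X.coord_chart h]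
    exact chartDeriv_J h _

theorem constVField_self (w : TM E M) (c : E × E) : constVField w c w = c :=
  (VField.coord_self _ w).symm.trans (eventuallyEq_coord_constVField w c).self_of_nhds

/-! ### Regularity in coordinates -/

theorem mdifferentiableAt_iff_coordFun {F : Type*} [NormedAddCommGroup F] [NormedSpace ℝ F]
    (h : w ∈ (chart w₀).source) {f : TM E M → F} :
    MDifferentiableAt (𝓘(ℝ, E).tangent) 𝓘(ℝ, F) f w ↔
      DifferentiableAt ℝ (coordFun w₀ f) (chart w₀ w) := by
  constructor
  · intro hf
    rw [← (chart w₀).left_inv h] at hf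
    exact (hf.comp (chart w₀ w)
      ((contMDiffAt_chart_symm h).mdifferentiableAt (by simp))).differentiableAt
  · intro hf
    refine (hf.mdifferentiableAt.comp w (mdifferentiableAt_chart h)).congr_of_eventuallyEq ?_
    filter_upwards [eventually_mem_chart_source h] with w' h'
    exact (coordFun_chart f h').symm

theorem contDiffAt_coordFun {F : Type*} [NormedAddCommGroup F] [NormedSpace ℝ F]
    (h : w ∈ (chart w₀).source) {f : TM E M → F}
    (hf : ContMDiffAt (𝓘(ℝ, E).tangent) 𝓘(ℝ, F) ∞ f w) :
    ContDiffAt ℝ ∞ (coordFun w₀ f) (chart w₀ w) := by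
  rw [← (chart w₀).left_inv h] at hf
  exact (hf.comp (chart w₀ w) (contMDiffAt_chart_symm h)).contDiffAt

theorem VField.trivializationAt_toMap_snd (X : VField E M) (h : w ∈ (chart w₀).source) :
    (trivializationAt (E × E) (TangentSpace (𝓘(ℝ, E).tangent)) w₀ (X.toMap w)).2 =
      chartDeriv w₀ w (X w) :=
  trivializationAt_snd (w := X.toMap w) (by rwa [extChartAt_source] at h)

theorem PiField.trivializationAt_toMap_snd (Y : PiField E M) (h : w ∈ (chart w₀).source) :
    (trivializationAt E (TangentSpace 𝓘(ℝ, E)) w₀.proj (Y.toMap w)).2 =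
      baseChartDeriv w₀ w (Y w) :=
  trivializationAt_snd (I := 𝓘(ℝ, E)) (x := w₀.proj)
    (w := (⟨w.proj, Y w⟩ : TangentBundle 𝓘(ℝ, E) M)) (mem_chart_source.1 h)

theorem VField.diffAt_iff {X : VField E M} :
    X.DiffAt w ↔ DifferentiableAt ℝ (X.coord w) (chart w w) := by
  have h := mem_extChartAt_source (I := 𝓘(ℝ, E).tangent) w
  refine (mdifferentiableAt_totalSpace _ _).trans
    ((and_iff_right (by exact mdifferentiableAt_id)).trans (Iff.trans ?_
    (mdifferentiableAt_iff_coordFun (f := fun w' => (chartDeriv w w' (X w') : E × E)) h)))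
  refine Filter.EventuallyEq.mdifferentiableAt_iff ?_
  filter_upwards [eventually_mem_chart_source h] with w' h'
  exact X.trivializationAt_toMap_snd h'

theorem PiField.diffAt_iff {Y : PiField E M} :
    Y.DiffAt w ↔ DifferentiableAt ℝ (Y.coord w) (chart w w) := by
  have h := mem_extChartAt_source (I := 𝓘(ℝ, E).tangent) w
  refine (mdifferentiableAt_totalSpace _ _).trans
    ((and_iff_right (by exact mdifferentiableAt_proj w)).trans (Iff.trans ?_
    (mdifferentiableAt_iff_coordFun (f := fun w' => (baseChartDeriv w w' (Y w') : E)) h)))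
  refine Filter.EventuallyEq.mdifferentiableAt_iff ?_
  filter_upwards [eventually_mem_chart_source h] with w' h'
  exact Y.trivializationAt_toMap_snd h'

theorem VField.SmoothOn.contDiffAt_coord {X : VField E M} (hX : X.SmoothOn (slit E M))
    (hw : w ∈ slit E M) : ContDiffAt ℝ ∞ (X.coord w) (chart w w) := by
  have h := mem_extChartAt_source (I := 𝓘(ℝ, E).tangent) w
  have hsnd := (contMDiffAt_totalSpace.1 (hX.contMDiffAt (slit_mem_nhds hw))).2
  refine contDiffAt_coordFun (f := fun w' => (chartDeriv w w' (X w') : E × E)) h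
    (hsnd.congr_of_eventuallyEq ?_)
  filter_upwards [eventually_mem_chart_source h] with w' h'
  exact (X.trivializationAt_toMap_snd h').symm

theorem PiField.SmoothOn.contDiffAt_coord {Y : PiField E M} (hY : Y.SmoothOn (slit E M))
    (hw : w ∈ slit E M) : ContDiffAt ℝ ∞ (Y.coord w) (chart w w) := by
  have h := mem_extChartAt_source (I := 𝓘(ℝ, E).tangent) w
  have hsnd := (contMDiffAt_totalSpace.1 (hY.contMDiffAt (slit_mem_nhds hw))).2
  refine contDiffAt_coordFun (f := fun w' => (baseChartDeriv w w' (Y w') : E)) h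
    (hsnd.congr_of_eventuallyEq ?_)
  filter_upwards [eventually_mem_chart_source h] with w' h'
  exact (Y.trivializationAt_toMap_snd h').symm

theorem diffAt_constVField (w : TM E M) (c : E × E) : (constVField w c).DiffAt w :=
  VField.diffAt_iff.2
    ((differentiableAt_const c).congr_of_eventuallyEq (eventuallyEq_coord_constVField w c))

theorem diffAt_constPiField (w : TM E M) (a : E) : (constPiField w a).DiffAt w :=
  PiField.diffAt_iff.2
    ((differentiableAt_const a).congr_of_eventuallyEq (eventuallyEq_coord_constPiField w a))

theorem diffAt_eta (w : TM E M) : (eta : PiField E M).DiffAt w :=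
  PiField.diffAt_iff.2 (differentiableAt_snd.congr_of_eventuallyEq (eventuallyEq_coord_eta w))

theorem VField.DiffAt.rhoField {X : VField E M} (hX : X.DiffAt w) : (rhoField X).DiffAt w :=
  PiField.diffAt_iff.2
    ((VField.diffAt_iff.1 hX).fst.congr_of_eventuallyEq (eventuallyEq_coord_rhoField X w))

/-! ### Differentials and brackets in coordinates -/

theorem dFun_apply {f : TM E M → ℝ} (h : w ∈ (chart w₀).source)
    (hf : DifferentiableAt ℝ (coordFun w₀ f) (chart w₀ w)) (x : TTan w) :
    dFun f w x = fderiv ℝ (coordFun w₀ f) (chart w₀ w) (chartDeriv w₀ w x) := by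
  have hcomp := mfderiv_comp w hf.mdifferentiableAt (mdifferentiableAt_chart h)
  have heq : coordFun w₀ f ∘ chart w₀ =ᶠ[𝓝 w] f := by
    filter_upwards [eventually_mem_chart_source h] with w' h' using coordFun_chart f h'
  rw [heq.mfderiv_eq, mfderiv_eq_fderiv] at hcomp
  exact congrArg (fun A : TTan w →L[ℝ] ℝ => A x) hcomp

theorem dFun_self {f : TM E M → ℝ} (hf : DifferentiableAt ℝ (coordFun w f) (chart w w))
    (x : E × E) : dFun f w x = fderiv ℝ (coordFun w f) (chart w w) x := by
  have h := dFun_apply (mem_extChartAt_source w) hf x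
  rw [chartDeriv_self] at h
  exact h

theorem dJ_apply {f : TM E M → ℝ} (h : w ∈ (chart w₀).source)
    (hf : DifferentiableAt ℝ (coordFun w₀ f) (chart w₀ w)) (x : TTan w) :
    dJ f w x = vertDeriv (coordFun w₀ f) (chart w₀ w) (chartDeriv w₀ w x).1 :=
  (dFun_apply h hf (J w x)).trans (by rw [chartDeriv_J h]; rfl)

theorem dJ_self {f : TM E M → ℝ} (hf : DifferentiableAt ℝ (coordFun w f) (chart w w))
    (x : E × E) : dJ f w x = vertDeriv (coordFun w f) (chart w w) x.1 := by
  have h := dJ_apply (mem_extChartAt_source w) hf x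
  rw [chartDeriv_self] at h
  exact h

theorem mpullbackWithin_chart_symm (X : VField E M) {z : E × E} (hz : z ∈ (chart w₀).target) :
    mpullbackWithin 𝓘(ℝ, E × E) (𝓘(ℝ, E).tangent) (chart w₀).symm X
      (range (𝓘(ℝ, E).tangent)) z = X.coord w₀ z := by
  have h := ContinuousLinearMap.inverse_eq
    (mfderivWithin_extChartAt_symm_comp_mfderiv_extChartAt (I := 𝓘(ℝ, E).tangent) hz)
    (mfderiv_extChartAt_comp_mfderivWithin_extChartAt_symm (I := 𝓘(ℝ, E).tangent) hz)
  exact congrArg (fun A : TTan ((chart w₀).symm z) →L[ℝ] E × E => A (X ((chart w₀).symm z))) h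

theorem bracket_apply (X Y : VField E M) (w : TM E M) :
    bracket X Y w = lieBracket ℝ (X.coord w) (Y.coord w) (chart w w) := by
  have hrange : (chart w).symm ⁻¹' univ ∩ range (𝓘(ℝ, E).tangent) = (univ : Set (E × E)) := by
    rw [preimage_univ, univ_inter]
    exact ModelWithCorners.range_eq_univ _
  have hinv : (chartDeriv w w).inverse = ContinuousLinearMap.id ℝ (E × E) := by
    rw [chartDeriv_self]
    exact ContinuousLinearMap.inverse_id
  have hpull : ∀ Z : VField E M, mpullbackWithin 𝓘(ℝ, E × E) (𝓘(ℝ, E).tangent)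
      (chart w).symm Z (range (𝓘(ℝ, E).tangent)) =ᶠ[𝓝 (chart w w)] Z.coord w := fun Z => by
    filter_upwards [extChartAt_target_mem_nhds w] with z hz
    exact mpullbackWithin_chart_symm Z hz
  have happly : bracket X Y w = (chartDeriv w w).inverse _ := mlieBracketWithin_apply
  rw [hrange] at happly
  refine (happly.trans (congrArg (fun A : (E × E) →L[ℝ] (E × E) => A _) hinv)).trans ?_
  refine Eq.trans ?_ ((hpull X).lieBracket_vectorField_eq (hpull Y))
  exact congrFun (lieBracketWithin_univ (𝕜 := ℝ) (E := E × E)) _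

theorem dFun_dJ_comp {f : TM E M → ℝ} {Z : VField E M}
    (hf : ContDiffAt ℝ 2 (coordFun w f) (chart w w)) (hZ : Z.DiffAt w) (x : E × E) :
    dFun (fun w' => dJ f w' (Z w')) w x =
      fderiv ℝ (vertDeriv (coordFun w f)) (chart w w) x (Z.coord w (chart w w)).1 +
        vertDeriv (coordFun w f) (chart w w) (fderiv ℝ (Z.coord w) (chart w w) x).1 := by
  have hdiff : ∀ᶠ w' in 𝓝 w, DifferentiableAt ℝ (coordFun w f) (chart w w') :=
    eventually_nhds_chart.1 (((hf.of_le one_le_two).eventually (by simp)).mono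
      fun _ h => h.differentiableAt one_ne_zero)
  have hcoord : coordFun w (fun w' => dJ f w' (Z w')) =ᶠ[𝓝 (chart w w)]
      fun z => vertDeriv (coordFun w f) z (Z.coord w z).1 := by
    refine eventually_nhds_chart.2 ?_
    filter_upwards [hdiff, eventually_mem_chart_source (mem_extChartAt_source w)] with w' h h'
    rw [coordFun_chart _ h', Z.coord_chart h', dJ_apply h' h]
  have hderiv := ((differentiableAt_vertDeriv hf).hasFDerivAt.clm_apply
    (VField.diffAt_iff.1 hZ).hasFDerivAt.fst).congr_of_eventuallyEq hcoord
  rw [dFun_self hderiv.differentiableAt, hderiv.fderiv]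
  simp [add_comm]

theorem dOne_dJ_apply {f : TM E M → ℝ} {X Y : VField E M}
    (hf : ContDiffAt ℝ 2 (coordFun w f) (chart w w)) (hX : X.DiffAt w) (hY : Y.DiffAt w) :
    dOne (dJ f) X Y w = ddJ (coordFun w f) (chart w w) (X w) (Y w) := by
  have hbracket : dJ f w (bracket X Y w) = vertDeriv (coordFun w f) (chart w w)
      (fderiv ℝ (Y.coord w) (chart w w) (X w) - fderiv ℝ (X.coord w) (chart w w) (Y w)).1 := by
    refine (dJ_self (hf.differentiableAt two_ne_zero) _).trans ?_
    have h := bracket_apply X Y w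
    rw [lieBracket, X.coord_self, Y.coord_self] at h
    exact congrArg (fun b : E × E => vertDeriv (coordFun w f) (chart w w) b.1) h
  have hX' := dFun_dJ_comp hf hX (Y w)
  have hY' := dFun_dJ_comp hf hY (X w)
  rw [X.coord_self] at hX'
  rw [Y.coord_self] at hY'
  rw [Prod.fst_sub, map_sub] at hbracket
  simp only [dOne, ddJ]
  linarith

end Coord

/-! ### The Finsler metric in coordinates -/

/-- The matrix of the Finsler metric in the chart around `w₀`: the Hessian, in the fibre
coordinates, of the coordinate expression of the energy. -/
def chartMetric (L : TM E M → ℝ) (w₀ : TM E M) : E × E → E →L[ℝ] E →L[ℝ] ℝ :=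
  vertDeriv (vertDeriv (coordFun w₀ (energy L)))

section Metric

variable {L : TM E M → ℝ} {w₀ w : TM E M}

theorem IsFinsler.contDiffAt_coordFun_energy (hL : IsFinsler L) (h : w ∈ (chart w₀).source)
    (hw : w ∈ slit E M) : ContDiffAt ℝ ∞ (coordFun w₀ (energy L)) (chart w₀ w) := by
  have hLw := contDiffAt_coordFun h (hL.smooth.contMDiffAt (slit_mem_nhds hw))
  exact (hLw.pow 2).div_const 2

theorem IsFinsler.contDiffAt_coordFun_energy_self (hL : IsFinsler L) (hw : w ∈ slit E M)
    (n : ℕ) : ContDiffAt ℝ n (coordFun w (energy L)) (chart w w) :=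
  (hL.contDiffAt_coordFun_energy (mem_extChartAt_source w) hw).of_le
    (by exact_mod_cast le_top)

theorem chart_smul (h : w ∈ (chart w₀).source) (t : ℝ) :
    chart w₀ (⟨w.proj, t • w.2⟩ : TM E M) = ((chart w₀ w).1, t • (chart w₀ w).2) := by
  have h' : (⟨w.proj, t • w.2⟩ : TM E M) ∈ (chart w₀).source :=
    mem_chart_source.2 (mem_chart_source.1 h)
  rw [chart_apply h, chart_apply h']
  exact Prod.ext rfl ((baseChartDeriv w₀ w).map_smul t w.2)

theorem IsFinsler.coordFun_energy_smul (hL : IsFinsler L) (h : w ∈ (chart w₀).source) {t : ℝ}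
    (ht : 0 < t) : coordFun w₀ (energy L) ((chart w₀ w).1, t • (chart w₀ w).2) =
      t ^ 2 * coordFun w₀ (energy L) (chart w₀ w) := by
  have h' : (⟨w.proj, t • w.2⟩ : TM E M) ∈ (chart w₀).source :=
    mem_chart_source.2 (mem_chart_source.1 h)
  rw [← chart_smul h, coordFun_chart _ h', coordFun_chart _ h, energy, hL.homogeneous w t ht,
    energy]
  ring

theorem IsFinsler.eventually_euler (hL : IsFinsler L) (hw : w ∈ slit E M) :
    ∀ᶠ z in 𝓝 (chart w w), vertDeriv (coordFun w (energy L)) z z.2 =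
      2 * coordFun w (energy L) z := by
  refine eventually_nhds_chart.2 ?_
  filter_upwards [eventually_mem_chart_source (mem_extChartAt_source w), slit_mem_nhds hw]
    with w' h hw'
  exact vertDeriv_snd_of_homogeneous (n := 2)
    ((hL.contDiffAt_coordFun_energy h hw').differentiableAt (by simp))
    fun t ht => hL.coordFun_energy_smul h ht

theorem metric_eq_chartMetric (hL : IsFinsler L) (h : w ∈ (chart w₀).source) (hw : w ∈ slit E M)
    (a b : PiFib w) : metric L w a b =
      chartMetric L w₀ (chart w₀ w) (baseChartDeriv w₀ w a) (baseChartDeriv w₀ w b) := by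
  have hq : ContDiffAt ℝ 2 (coordFun w₀ (energy L)) (chart w₀ w) :=
    (hL.contDiffAt_coordFun_energy h hw).of_le (by norm_cast)
  have hfibre : (fun y : E => energy L (⟨w.proj, y⟩ : TM E M)) = fun y =>
      coordFun w₀ (energy L)
        (extChartAt 𝓘(ℝ, E) w₀.proj w.proj, (baseChartDeriv w₀ w : E →L[ℝ] E) y) := by
    ext1 y
    have hy : (⟨w.proj, y⟩ : TM E M) ∈ (chart w₀).source :=
      mem_chart_source.2 (mem_chart_source.1 h)
    rw [← coordFun_chart (energy L) hy, chart_apply hy]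
    rfl
  rw [chart_apply h] at hq ⊢
  rw [metric, hfibre]
  exact fderiv_fderiv_comp_prodMk (E := E) (A := baseChartDeriv w₀ w) (y := w.2) hq a b

theorem metric_self (hL : IsFinsler L) (hw : w ∈ slit E M) (a b : E) :
    metric L w a b = chartMetric L w (chart w w) a b := by
  have h := metric_eq_chartMetric hL (mem_extChartAt_source w) hw a b
  rw [baseChartDeriv_self] at h
  exact h

theorem metric_rho (hL : IsFinsler L) (hw : w ∈ slit E M) (Y : PiField E M) (x : E × E) :
    metric L w (Y w) (rho w x) =
      chartMetric L w (chart w w) (Y.coord w (chart w w)) x.1 := by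
  rw [Y.coord_self]
  exact (congrArg (metric L w (Y w)) (rho_apply w x)).trans (metric_self hL hw _ _)

theorem chartMetric_comm (hL : IsFinsler L) (hw : w ∈ slit E M) (a b : E) :
    chartMetric L w (chart w w) a b = chartMetric L w (chart w w) b a :=
  vertDeriv_vertDeriv_comm (hL.contDiffAt_coordFun_energy_self hw 2) a b

theorem eq_zero_of_chartMetric_self (hL : IsFinsler L) (hw : w ∈ slit E M) {a : E}
    (h : chartMetric L w (chart w w) a a = 0) : a = 0 := by
  by_contra ha
  have hpos := hL.posDef w hw a ha
  rw [metric_self hL hw, h] at hpos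
  exact hpos.false

theorem eq_of_chartMetric_eq (hL : IsFinsler L) (hw : w ∈ slit E M) {a a' : E}
    (h : ∀ b, chartMetric L w (chart w w) a b = chartMetric L w (chart w w) a' b) : a = a' := by
  refine sub_eq_zero.1 (eq_zero_of_chartMetric_self hL hw ?_)
  rw [map_sub (chartMetric L w (chart w w)), sub_apply, h, sub_self]

theorem chartMetric_snd (hL : IsFinsler L) (hw : w ∈ slit E M) (a : E) :
    chartMetric L w (chart w w) a (chart w w).2 =
      vertDeriv (coordFun w (energy L)) (chart w w) a :=
  vertDeriv_vertDeriv_snd (hL.contDiffAt_coordFun_energy_self hw 2) (hL.eventually_euler hw) a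

theorem chartMetric_snd_snd (hL : IsFinsler L) (hw : w ∈ slit E M) :
    chartMetric L w (chart w w) (chart w w).2 (chart w w).2 = 2 * energy L w := by
  rw [chartMetric_snd hL hw, (hL.eventually_euler hw).self_of_nhds,
    coordFun_chart _ (mem_extChartAt_source w)]

theorem contDiffAt_chartMetric (hL : IsFinsler L) (hw : w ∈ slit E M) :
    ContDiffAt ℝ 2 (chartMetric L w) (chart w w) :=
  contDiffAt_vertDeriv (m := 2) (n := 3)
    (contDiffAt_vertDeriv (hL.contDiffAt_coordFun_energy_self hw 4) (by norm_num)) (by norm_num)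

theorem differentiableAt_chartMetric (hL : IsFinsler L) (hw : w ∈ slit E M) :
    DifferentiableAt ℝ (chartMetric L w) (chart w w) :=
  (contDiffAt_chartMetric hL hw).differentiableAt two_ne_zero

theorem fderiv_chartMetric_comm (hL : IsFinsler L) (hw : w ∈ slit E M) (x : E × E) (a b : E) :
    fderiv ℝ (chartMetric L w) (chart w w) x a b = fderiv ℝ (chartMetric L w) (chart w w) x b a :=
  fderiv_vertDeriv_vertDeriv_comm (hL.contDiffAt_coordFun_energy_self hw 3) x a b

theorem fderiv_chartMetric_vertical_snd (hL : IsFinsler L) (hw : w ∈ slit E M) (a c : E) :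
    fderiv ℝ (chartMetric L w) (chart w w) (0, c) a (chart w w).2 = 0 :=
  fderiv_vertDeriv_vertDeriv_snd (hL.contDiffAt_coordFun_energy_self hw 3)
    (hL.eventually_euler hw) a c

theorem eventuallyEq_coordFun_metric (hL : IsFinsler L) (hw : w ∈ slit E M) (Y Z : PiField E M) :
    coordFun w (fun w' => metric L w' (Y w') (Z w')) =ᶠ[𝓝 (chart w w)]
      fun z => chartMetric L w z (Y.coord w z) (Z.coord w z) := by
  refine eventually_nhds_chart.2 ?_
  filter_upwards [eventually_mem_chart_source (mem_extChartAt_source w), slit_mem_nhds hw]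
    with w' h hw'
  rw [coordFun_chart _ h, metric_eq_chartMetric hL h hw', Y.coord_chart h, Z.coord_chart h]

end Metric

/-! ### The Cartan connection -/

/-- The covariant derivative of `Y` at `w`, read in the chart around `w`. -/
def covDeriv (D : PiConnection E M) (w : TM E M) (Y : PiField E M) : E × E →L[ℝ] E := D.D Y w

/-- The Christoffel symbols at `w` of a connection on `π⁻¹(TM)`: `christoffel D w a x` is the
derivative along `x` of the field with constant coordinates `a` in the chart around `w`. -/
def christoffel (D : PiConnection E M) (w : TM E M) (a : E) : E × E →L[ℝ] E :=
  covDeriv D w (constPiField w a)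

namespace IsCartan

variable {L : TM E M → ℝ} {D : PiConnection E M} {w : TM E M}

theorem dFun_metric (hD : IsCartan L D) (hL : IsFinsler L) (hw : w ∈ slit E M) {Y Z : PiField E M}
    (hY : Y.DiffAt w) (hZ : Z.DiffAt w) (x : E × E) :
    dFun (fun w' => metric L w' (Y w') (Z w')) w x =
      chartMetric L w (chart w w) (covDeriv D w Y x) (Z.coord w (chart w w)) +
        chartMetric L w (chart w w) (Y.coord w (chart w w)) (covDeriv D w Z x) := by
  rw [Y.coord_self, Z.coord_self]
  exact (hD.metric_compatible w hw Y Z hY hZ x).trans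
    (congrArg₂ (· + ·) (metric_self hL hw _ _) (metric_self hL hw _ _))

theorem fderiv_chartMetric_coord (hD : IsCartan L D) (hL : IsFinsler L) (hw : w ∈ slit E M)
    {Y Z : PiField E M} (hY : Y.DiffAt w) (hZ : Z.DiffAt w) (x : E × E) :
    fderiv ℝ (chartMetric L w) (chart w w) x (Y.coord w (chart w w)) (Z.coord w (chart w w)) =
      chartMetric L w (chart w w) (covDeriv D w Y x - fderiv ℝ (Y.coord w) (chart w w) x)
        (Z.coord w (chart w w)) +
      chartMetric L w (chart w w) (Y.coord w (chart w w))
        (covDeriv D w Z x - fderiv ℝ (Z.coord w) (chart w w) x) := by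
  have hY' := PiField.diffAt_iff.1 hY
  have hZ' := PiField.diffAt_iff.1 hZ
  have heq := eventuallyEq_coordFun_metric hL hw Y Z
  have hg := differentiableAt_chartMetric hL hw
  have h := hD.dFun_metric hL hw hY hZ x
  rw [dFun_self (((hg.clm_apply hY').clm_apply hZ').congr_of_eventuallyEq heq), heq.fderiv_eq,
    fderiv_bilinear_apply hg hY' hZ'] at h
  rw [map_sub (chartMetric L w (chart w w)), map_sub (chartMetric L w (chart w w) _), sub_apply]
  linarith

theorem fderiv_chartMetric (hD : IsCartan L D) (hL : IsFinsler L) (hw : w ∈ slit E M)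
    (x : E × E) (a b : E) : fderiv ℝ (chartMetric L w) (chart w w) x a b =
      chartMetric L w (chart w w) (christoffel D w a x) b +
        chartMetric L w (chart w w) a (christoffel D w b x) := by
  have h := hD.fderiv_chartMetric_coord hL hw (diffAt_constPiField w a) (diffAt_constPiField w b) x
  rwa [(eventuallyEq_coord_constPiField w a).fderiv_eq,
    (eventuallyEq_coord_constPiField w b).fderiv_eq, fderiv_fun_const, fderiv_fun_const,
    (eventuallyEq_coord_constPiField w a).self_of_nhds,
    (eventuallyEq_coord_constPiField w b).self_of_nhds, Pi.zero_apply, zero_apply, sub_zero,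
    sub_zero] at h

theorem covDeriv_apply (hD : IsCartan L D) (hL : IsFinsler L) (hw : w ∈ slit E M) {Y : PiField E M}
    (hY : Y.DiffAt w) (x : E × E) : covDeriv D w Y x =
      fderiv ℝ (Y.coord w) (chart w w) x + christoffel D w (Y.coord w (chart w w)) x := by
  refine sub_eq_iff_eq_add'.1 (eq_of_chartMetric_eq hL hw fun b => ?_)
  have h := hD.fderiv_chartMetric_coord hL hw hY (diffAt_constPiField w b) x
  rw [(eventuallyEq_coord_constPiField w b).fderiv_eq,
    (eventuallyEq_coord_constPiField w b).self_of_nhds, fderiv_fun_const, Pi.zero_apply,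
    zero_apply, sub_zero, hD.fderiv_chartMetric hL hw] at h
  exact (add_right_cancel h).symm

theorem covDeriv_eta (hD : IsCartan L D) (hL : IsFinsler L) (hw : w ∈ slit E M) (x : E × E) :
    covDeriv D w eta x = x.2 + christoffel D w (chart w w).2 x := by
  rw [hD.covDeriv_apply hL hw (diffAt_eta w), (eventuallyEq_coord_eta w).fderiv_eq, fderiv_snd,
    (eventuallyEq_coord_eta w).self_of_nhds]
  rfl

theorem christoffel_zero (hD : IsCartan L D) (hL : IsFinsler L) (hw : w ∈ slit E M) (x : E × E) :
    christoffel D w 0 x = 0 := by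
  refine eq_of_chartMetric_eq hL hw fun b => ?_
  simpa using (hD.fderiv_chartMetric hL hw x 0 b).symm

theorem torsion_constVField (hD : IsCartan L D) (hL : IsFinsler L) (hw : w ∈ slit E M)
    (x y : E × E) : D.torsion (constVField w x) (constVField w y) w =
      christoffel D w y.1 x - christoffel D w x.1 y := by
  have hcov : ∀ x y : E × E,
      covDeriv D w (rhoField (constVField w y)) x = christoffel D w y.1 x := by
    intro x y
    have hcoord : (rhoField (constVField w y)).coord w =ᶠ[𝓝 (chart w w)] fun _ => y.1 := by
      filter_upwards [eventuallyEq_coord_rhoField (constVField w y) w,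
        eventuallyEq_coord_constVField w y] with z h1 h2
      rw [h1, h2]
    rw [hD.covDeriv_apply hL hw (diffAt_constVField w y).rhoField, hcoord.fderiv_eq,
      hcoord.self_of_nhds, fderiv_fun_const, Pi.zero_apply, zero_apply, zero_add]
  have hbracket : bracket (constVField w x) (constVField w y) w = 0 := by
    rw [bracket_apply, lieBracket, (eventuallyEq_coord_constVField w x).fderiv_eq,
      (eventuallyEq_coord_constVField w y).fderiv_eq, fderiv_fun_const, fderiv_fun_const]
    exact sub_zero (0 : E × E)
  rw [PiConnection.torsion, hbracket, map_zero, sub_zero, constVField_self, constVField_self]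
  exact congrArg₂ (fun a b : E => a - b) (hcov x y) (hcov y x)

theorem exists_horizontal (hD : IsCartan L D) (hw : w ∈ slit E M) (a : E) :
    ∃ c : E, covDeriv D w eta (a, c) = 0 := by
  have hmem : ∀ x : TTan w, x ∈ LinearMap.ker (rho w : TTan w →ₗ[ℝ] PiFib w) ⊔
      LinearMap.ker (D.K w : TTan w →ₗ[ℝ] PiFib w) := by
    rw [(hD.regular w hw).sup_eq_top]
    exact fun _ => Submodule.mem_top
  obtain ⟨v, hv, h, hh, hvh⟩ := Submodule.mem_sup.1 (hmem ((a, 0) : E × E))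
  have hv1 : (v : E × E).1 = 0 := (rho_apply w v).symm.trans hv
  have hh1 : (h : E × E).1 = a := by
    have hfst : (v : E × E).1 + (h : E × E).1 = a := congrArg (fun y : E × E => y.1) hvh
    rwa [hv1, zero_add] at hfst
  exact ⟨(h : E × E).2, hh1 ▸ hh⟩

theorem two_mul_chartMetric_christoffel_vertical (hD : IsCartan L D) (hL : IsFinsler L)
    (hw : w ∈ slit E M) (a b c : E) :
    2 * chartMetric L w (chart w w) (christoffel D w a (0, c)) b =
      fderiv ℝ (chartMetric L w) (chart w w) (0, c) a b := by
  obtain ⟨a', ha⟩ := hD.exists_horizontal hw a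
  obtain ⟨b', hb⟩ := hD.exists_horizontal hw b
  have h := hD.hhv_torsion w hw (constVField w (0, c)) (constVField w (a, a'))
    (constVField w (b, b')) (diffAt_constVField w _) (diffAt_constVField w _)
    (diffAt_constVField w _) (by rw [constVField_self]; exact rho_apply w _)
    (by rw [constVField_self]; exact ha) (by rw [constVField_self]; exact hb)
  rw [hD.torsion_constVField hL hw, hD.torsion_constVField hL hw, hD.christoffel_zero hL hw,
    hD.christoffel_zero hL hw, sub_zero, sub_zero, constVField_self, constVField_self, rho_apply,
    rho_apply, metric_self hL hw, metric_self hL hw] at h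
  rw [hD.fderiv_chartMetric hL hw, chartMetric_comm hL hw a]
  linarith

theorem christoffel_comm_of_horizontal (hD : IsCartan L D) (hL : IsFinsler L) (hw : w ∈ slit E M)
    {x y : E × E} (hx : covDeriv D w eta x = 0) (hy : covDeriv D w eta y = 0) :
    christoffel D w y.1 x = christoffel D w x.1 y := by
  have h := hD.hh_torsion w hw (constVField w x) (constVField w y) (diffAt_constVField w _)
    (diffAt_constVField w _) (by rw [constVField_self]; exact hx)
    (by rw [constVField_self]; exact hy)
  exact sub_eq_zero.1 ((hD.torsion_constVField hL hw x y).symm.trans h)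

theorem covDeriv_eta_vertical (hD : IsCartan L D) (hL : IsFinsler L) (hw : w ∈ slit E M) (c : E) :
    covDeriv D w eta (0, c) = c := by
  have h0 : christoffel D w (chart w w).2 (0, c) = 0 := by
    refine eq_of_chartMetric_eq hL hw fun b => ?_
    have h := hD.two_mul_chartMetric_christoffel_vertical hL hw (chart w w).2 b c
    rw [fderiv_chartMetric_comm hL hw, fderiv_chartMetric_vertical_snd hL hw] at h
    rw [map_zero, zero_apply]
    linarith
  rw [hD.covDeriv_eta hL hw, h0, add_zero]

theorem fderiv_vertDeriv_energy (hD : IsCartan L D) (hL : IsFinsler L) (hw : w ∈ slit E M)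
    (x : E × E) (c : E) :
    fderiv ℝ (vertDeriv (coordFun w (energy L))) (chart w w) x c =
      chartMetric L w (chart w w) (christoffel D w c x) (chart w w).2 +
        chartMetric L w (chart w w) c (covDeriv D w eta x) := by
  have heq : (fun z => vertDeriv (coordFun w (energy L)) z c) =ᶠ[𝓝 (chart w w)]
      fun z => chartMetric L w z c z.2 := by
    filter_upwards [(hL.eventually_euler hw).eventually_nhds,
      (hL.contDiffAt_coordFun_energy_self hw 2).eventually (by simp)] with z h1 h2
    exact (vertDeriv_vertDeriv_snd h2 h1 c).symm
  have hd : DifferentiableAt ℝ (vertDeriv (coordFun w (energy L))) (chart w w) :=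
    differentiableAt_vertDeriv (hL.contDiffAt_coordFun_energy_self hw 2)
  have happly : fderiv ℝ (fun z => vertDeriv (coordFun w (energy L)) z c) (chart w w) x =
      fderiv ℝ (vertDeriv (coordFun w (energy L))) (chart w w) x c := by
    rw [(hd.hasFDerivAt.clm_apply (hasFDerivAt_const c _)).fderiv]
    simp
  rw [← happly, heq.fderiv_eq, fderiv_bilinear_apply (differentiableAt_chartMetric hL hw)
    (differentiableAt_const c) differentiableAt_snd, hD.fderiv_chartMetric hL hw,
    hD.covDeriv_eta hL hw, fderiv_snd, fderiv_fun_const, Pi.zero_apply, zero_apply, map_zero,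
    zero_apply, map_add, ContinuousLinearMap.coe_snd']
  ring

theorem fderiv_energy_of_horizontal (hD : IsCartan L D) (hL : IsFinsler L) (hw : w ∈ slit E M)
    {x : E × E} (hx : covDeriv D w eta x = 0) :
    fderiv ℝ (coordFun w (energy L)) (chart w w) x = 0 := by
  have hchr : christoffel D w (chart w w).2 x = -x.2 := by
    rw [hD.covDeriv_eta hL hw] at hx
    exact eq_neg_of_add_eq_zero_right hx
  have h := hD.fderiv_vertDeriv_energy hL hw x (chart w w).2
  rw [hx, map_zero, add_zero, hchr, map_neg, neg_apply, chartMetric_snd hL hw,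
    fderiv_vertDeriv_snd (hL.contDiffAt_coordFun_energy_self hw 2) (hL.eventually_euler hw)] at h
  linarith

theorem fderiv_vertDeriv_energy_of_horizontal (hD : IsCartan L D) (hL : IsFinsler L)
    (hw : w ∈ slit E M) {s : E} (hs : covDeriv D w eta ((chart w w).2, s) = 0) (c : E) :
    fderiv ℝ (vertDeriv (coordFun w (energy L))) (chart w w) ((chart w w).2, s) c =
      fderiv ℝ (coordFun w (energy L)) (chart w w) (c, 0) := by
  obtain ⟨c', hc⟩ := hD.exists_horizontal hw c
  have hchr : christoffel D w c ((chart w w).2, s) = -c' := by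
    rw [hD.christoffel_comm_of_horizontal hL hw (y := (c, c')) hs hc]
    rw [hD.covDeriv_eta hL hw] at hc
    exact eq_neg_of_add_eq_zero_right hc
  have hE := hD.fderiv_energy_of_horizontal hL hw hc
  rw [← Prod.fst_add_snd (c, c'), map_add] at hE
  rw [hD.fderiv_vertDeriv_energy hL hw, hchr, hs, map_zero, add_zero, map_neg, neg_apply,
    chartMetric_snd hL hw]
  exact (eq_neg_of_add_eq_zero_left hE).symm

end IsCartan

/-! ### The canonical spray -/

section Spray

variable {L : TM E M → ℝ} {G : VField E M} {w : TM E M}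

theorem IsCanonicalSpray.diffAt (hG : IsCanonicalSpray L G) (hw : w ∈ slit E M) : G.DiffAt w :=
  VField.diffAt_iff.2 ((hG.smooth.contDiffAt_coord hw).differentiableAt (by simp))

theorem IsCanonicalSpray.ddJ_energy (hG : IsCanonicalSpray L G) (hL : IsFinsler L)
    (hw : w ∈ slit E M) (x : E × E) :
    ddJ (coordFun w (energy L)) (chart w w) (G.coord w (chart w w)) x =
      -fderiv ℝ (coordFun w (energy L)) (chart w w) x := by
  have hq := hL.contDiffAt_coordFun_energy_self hw 2
  have h := hG.eq w hw (constVField w x) (diffAt_constVField w x)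
  rwa [dOne_dJ_apply hq (hG.diffAt hw) (diffAt_constVField w x), constVField_self,
    dFun_self (hq.differentiableAt two_ne_zero), ← G.coord_self] at h

theorem IsCanonicalSpray.coord_eq_of_ddJ_energy (hG : IsCanonicalSpray L G) (hL : IsFinsler L)
    (hw : w ∈ slit E M) {v : E × E}
    (hv : ∀ x, ddJ (coordFun w (energy L)) (chart w w) v x =
      -fderiv ℝ (coordFun w (energy L)) (chart w w) x) : G.coord w (chart w w) = v :=
  eq_of_ddJ_eq (fun _ => eq_zero_of_chartMetric_self hL hw)
    fun x => (hG.ddJ_energy hL hw x).trans (hv x).symm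

theorem IsCanonicalSpray.exists_coord_eq_horizontal {D : PiConnection E M}
    (hG : IsCanonicalSpray L G) (hL : IsFinsler L) (hD : IsCartan L D) (hw : w ∈ slit E M) :
    ∃ s : E, covDeriv D w eta ((chart w w).2, s) = 0 ∧
      G.coord w (chart w w) = ((chart w w).2, s) := by
  obtain ⟨s, hs⟩ := hD.exists_horizontal hw (chart w w).2
  refine ⟨s, hs, hG.coord_eq_of_ddJ_energy hL hw fun x => ?_⟩
  have hx : fderiv ℝ (coordFun w (energy L)) (chart w w) x =
      fderiv ℝ (coordFun w (energy L)) (chart w w) (x.1, 0) +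
        vertDeriv (coordFun w (energy L)) (chart w w) x.2 := by
    nth_rw 1 [← Prod.fst_add_snd x, map_add]
    rfl
  rw [ddJ, hD.fderiv_vertDeriv_energy_of_horizontal hL hw hs,
    fderiv_vertDeriv_snd (hL.contDiffAt_coordFun_energy_self hw 2) (hL.eventually_euler hw)]
  linarith

end Spray

/-! ### Concurrent fields -/

/-- The function `B = g(ζ, η)`. -/
def pairing (L : TM E M → ℝ) (ζ : PiField E M) (w : TM E M) : ℝ := metric L w (ζ w) (eta w)

/-- The squared length `p² = g(ζ, ζ)`. -/
def sqLength (L : TM E M → ℝ) (ζ : PiField E M) (w : TM E M) : ℝ := metric L w (ζ w) (ζ w)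

theorem sqLength_nonneg {L : TM E M → ℝ} {w : TM E M} (hL : IsFinsler L) (hw : w ∈ slit E M)
    (ζ : PiField E M) : 0 ≤ sqLength L ζ w := by
  rcases eq_or_ne (ζ w) 0 with h | h
  · rw [sqLength, h]
    exact ((metric_self hL hw 0 0).trans (map_zero _)).ge
  · exact (hL.posDef w hw _ h).le

theorem chartMetric_coord_self {L : TM E M → ℝ} {w : TM E M} (hL : IsFinsler L)
    (hw : w ∈ slit E M) (ζ : PiField E M) :
    chartMetric L w (chart w w) (ζ.coord w (chart w w)) (ζ.coord w (chart w w)) =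
      sqLength L ζ w := by
  rw [ζ.coord_self]
  exact (metric_self hL hw _ _).symm

theorem coordFun_pairing_self {L : TM E M → ℝ} {w : TM E M} (hL : IsFinsler L)
    (hw : w ∈ slit E M) (ζ : PiField E M) : coordFun w (pairing L ζ) (chart w w) =
      chartMetric L w (chart w w) (ζ.coord w (chart w w)) (chart w w).2 := by
  rw [coordFun_chart _ (mem_extChartAt_source w), ζ.coord_self, chart_self_snd]
  exact metric_self hL hw _ _

namespace IsConcurrent

variable {L : TM E M → ℝ} {ζ : PiField E M} {D : PiConnection E M} {w : TM E M}

theorem covDeriv_eq_neg_fst (h : D.D ζ w = -rho w) (x : E × E) : covDeriv D w ζ x = -x.1 := by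
  rw [covDeriv, h]
  exact congrArg (fun a : E => -a) (rho_apply w x)

theorem contDiffAt_coord (hζ : IsConcurrent L ζ) (hw : w ∈ slit E M) :
    ContDiffAt ℝ 2 (ζ.coord w) (chart w w) :=
  (hζ.1.contDiffAt_coord hw).of_le (by norm_cast)

theorem diffAt (hζ : IsConcurrent L ζ) (hw : w ∈ slit E M) : ζ.DiffAt w :=
  PiField.diffAt_iff.2 ((hζ.contDiffAt_coord hw).differentiableAt two_ne_zero)

theorem contDiffAt_coordFun_sqLength (hζ : IsConcurrent L ζ) (hL : IsFinsler L)
    (hw : w ∈ slit E M) : ContDiffAt ℝ 2 (coordFun w (sqLength L ζ)) (chart w w) :=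
  (((contDiffAt_chartMetric hL hw).clm_apply (hζ.contDiffAt_coord hw)).clm_apply
    (hζ.contDiffAt_coord hw)).congr_of_eventuallyEq (eventuallyEq_coordFun_metric hL hw ζ ζ)

theorem contDiffAt_coordFun_pairing (hζ : IsConcurrent L ζ) (hL : IsFinsler L)
    (hw : w ∈ slit E M) : ContDiffAt ℝ 2 (coordFun w (pairing L ζ)) (chart w w) :=
  (((contDiffAt_chartMetric hL hw).clm_apply (hζ.contDiffAt_coord hw)).clm_apply
    (contDiffAt_snd.congr_of_eventuallyEq (eventuallyEq_coord_eta w))).congr_of_eventuallyEq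
      (eventuallyEq_coordFun_metric hL hw ζ eta)

theorem dFun_sqLength (hζ : IsConcurrent L ζ) (hL : IsFinsler L) (hw : w ∈ slit E M)
    (x : E × E) : dFun (sqLength L ζ) w x = -2 * metric L w (ζ w) (rho w x) := by
  obtain ⟨D, hD, hDζ⟩ := hζ.2
  have h := hD.dFun_metric hL hw (hζ.diffAt hw) (hζ.diffAt hw) x
  rw [covDeriv_eq_neg_fst (hDζ w hw), map_neg, neg_apply, map_neg, chartMetric_comm hL hw,
    ← metric_rho hL hw] at h
  refine h.trans ?_
  ring

theorem dFun_pairing (hζ : IsConcurrent L ζ) (hL : IsFinsler L) (hD : IsCartan L D)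
    (hDζ : ∀ w ∈ slit E M, D.D ζ w = -rho w) (hw : w ∈ slit E M) (x : E × E) :
    dFun (pairing L ζ) w x = -chartMetric L w (chart w w) x.1 (chart w w).2 +
      chartMetric L w (chart w w) (ζ.coord w (chart w w)) (covDeriv D w eta x) := by
  have h := hD.dFun_metric hL hw (hζ.diffAt hw) (diffAt_eta w) x
  rwa [covDeriv_eq_neg_fst (hDζ w hw), (eventuallyEq_coord_eta w).self_of_nhds, map_neg,
    neg_apply] at h

theorem dJ_pairing (hζ : IsConcurrent L ζ) (hL : IsFinsler L) (hw : w ∈ slit E M)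
    (x : E × E) : dJ (pairing L ζ) w x = metric L w (ζ w) (rho w x) := by
  obtain ⟨D, hD, hDζ⟩ := hζ.2
  have h := hζ.dFun_pairing hL hD hDζ hw (0, x.1)
  rw [map_zero, zero_apply, neg_zero, zero_add, hD.covDeriv_eta_vertical hL hw, ← J_apply w x,
    ← metric_rho hL hw] at h
  exact h

theorem eventually_vertDeriv_pairing (hζ : IsConcurrent L ζ) (hL : IsFinsler L)
    (hw : w ∈ slit E M) : ∀ᶠ z in 𝓝 (chart w w), ∀ a,
      vertDeriv (coordFun w (pairing L ζ)) z a = chartMetric L w z (ζ.coord w z) a := by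
  have hB := (hζ.contDiffAt_coordFun_pairing hL hw).eventually (by simp)
  refine eventually_nhds_chart.2 ?_
  filter_upwards [eventually_mem_chart_source (mem_extChartAt_source w), slit_mem_nhds hw,
    eventually_nhds_chart.1 hB] with w' h hw' hB' a
  obtain ⟨x, hx⟩ := (isInvertible_chartDeriv h).surjective (a, 0)
  have hJ := hζ.dJ_pairing hL hw' x
  rwa [dJ_apply h (hB'.differentiableAt two_ne_zero), metric_eq_chartMetric hL h hw',
    baseChartDeriv_rho h, hx, ← ζ.coord_chart h] at hJ

theorem eventually_fderiv_sqLength (hζ : IsConcurrent L ζ) (hL : IsFinsler L)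
    (hw : w ∈ slit E M) : ∀ᶠ z in 𝓝 (chart w w), ∀ x,
      fderiv ℝ (coordFun w (sqLength L ζ)) z x = -2 * chartMetric L w z (ζ.coord w z) x.1 := by
  have hP := (hζ.contDiffAt_coordFun_sqLength hL hw).eventually (by simp)
  refine eventually_nhds_chart.2 ?_
  filter_upwards [eventually_mem_chart_source (mem_extChartAt_source w), slit_mem_nhds hw,
    eventually_nhds_chart.1 hP] with w' h hw' hP' x
  obtain ⟨y, rfl⟩ := (isInvertible_chartDeriv h).surjective x
  have hd := hζ.dFun_sqLength hL hw' y
  rwa [dFun_apply h (hP'.differentiableAt two_ne_zero), metric_eq_chartMetric hL h hw',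
    baseChartDeriv_rho h, ← ζ.coord_chart h] at hd

theorem ddJ_pairing (hζ : IsConcurrent L ζ) (hL : IsFinsler L) (hw : w ∈ slit E M)
    (x y : E × E) : ddJ (coordFun w (pairing L ζ)) (chart w w) x y = 0 := by
  refine ddJ_eq_zero (k := -1 / 2) (hζ.contDiffAt_coordFun_sqLength hL hw)
    (differentiableAt_vertDeriv (hζ.contDiffAt_coordFun_pairing hL hw)) ?_ x y
  filter_upwards [hζ.eventually_vertDeriv_pairing hL hw, hζ.eventually_fderiv_sqLength hL hw]
    with z hB hP x
  rw [hB, hP]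
  ring

theorem fderiv_pairing_spray (hζ : IsConcurrent L ζ) (hL : IsFinsler L) {G : VField E M}
    (hG : IsCanonicalSpray L G) (hw : w ∈ slit E M) :
    fderiv ℝ (coordFun w (pairing L ζ)) (chart w w) (G.coord w (chart w w)) =
      -(2 * energy L w) := by
  obtain ⟨D, hD, hDζ⟩ := hζ.2
  obtain ⟨s, hs, hGs⟩ := hG.exists_coord_eq_horizontal hL hD hw
  have hB := (hζ.contDiffAt_coordFun_pairing hL hw).differentiableAt two_ne_zero
  rw [← dFun_self hB, hζ.dFun_pairing hL hD hDζ hw, hGs, hs, map_zero, add_zero,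
    chartMetric_snd_snd hL hw]

theorem fderiv_chartMetric_add_fderiv_coord_vertical (hζ : IsConcurrent L ζ) (hL : IsFinsler L)
    (hw : w ∈ slit E M) (a c : E) :
    fderiv ℝ (chartMetric L w) (chart w w) (0, c) (ζ.coord w (chart w w)) a +
      chartMetric L w (chart w w) (fderiv ℝ (ζ.coord w) (chart w w) (0, c)) a = 0 := by
  have heq : (fun z => vertDeriv (coordFun w (pairing L ζ)) z a) =ᶠ[𝓝 (chart w w)]
      fun z => chartMetric L w z (ζ.coord w z) a :=
    (hζ.eventually_vertDeriv_pairing hL hw).mono fun z hz => hz a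
  have hv : DifferentiableAt ℝ (vertDeriv (coordFun w (pairing L ζ))) (chart w w) :=
    differentiableAt_vertDeriv (hζ.contDiffAt_coordFun_pairing hL hw)
  have h := congrArg (fun A : (E × E) →L[ℝ] ℝ => A (0, c)) heq.fderiv_eq
  rw [fderiv_bilinear_apply (differentiableAt_chartMetric hL hw)
    (PiField.diffAt_iff.1 (hζ.diffAt hw)) (differentiableAt_const a),
    fderiv_clm_apply hv (differentiableAt_const a)] at h
  simp only [fderiv_fun_const, Pi.zero_apply, zero_apply, map_zero, add_zero, zero_add,
    ContinuousLinearMap.comp_zero, ContinuousLinearMap.flip_apply] at h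
  have h0 := hζ.ddJ_pairing hL hw (0, c) (a, 0)
  rw [ddJ, map_zero, sub_zero] at h0
  rw [← h, h0]

theorem fderiv_coord_vertical (hζ : IsConcurrent L ζ) (hL : IsFinsler L) (hw : w ∈ slit E M)
    (c : E) : fderiv ℝ (ζ.coord w) (chart w w) (0, c) = 0 := by
  obtain ⟨D, hD, hDζ⟩ := hζ.2
  have hcov := hD.covDeriv_apply hL hw (hζ.diffAt hw) (0, c)
  rw [covDeriv_eq_neg_fst (hDζ w hw), neg_zero] at hcov
  have hmetric := hζ.fderiv_chartMetric_add_fderiv_coord_vertical hL hw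
    (fderiv ℝ (ζ.coord w) (chart w w) (0, c)) c
  rw [← hD.two_mul_chartMetric_christoffel_vertical hL hw, eq_neg_of_add_eq_zero_right hcov.symm,
    map_neg, neg_apply] at hmetric
  exact eq_zero_of_chartMetric_self hL hw (by linarith)

end IsConcurrent

/-! ### The change of the spray and of the Barthel connection -/

theorem IsBarthel.exists_spray_apply_eq {L : TM E M → ℝ} {Γ : ∀ w : TM E M, TTan w →L[ℝ] TTan w}
    (hΓ : IsBarthel L Γ) : ∃ G : VField E M, IsCanonicalSpray L G ∧
      ∀ w ∈ slit E M, ∀ x : E × E, Γ w x = fderiv ℝ (G.coord w) (chart w w) (0, x.1) -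
        (0, (fderiv ℝ (G.coord w) (chart w w) x).1) := by
  obtain ⟨G, hG, hΓG⟩ := hΓ
  refine ⟨G, hG, fun w hw x => ?_⟩
  have hlie : ∀ {X : VField E M} {y : E × E}, X.coord w =ᶠ[𝓝 (chart w w)] (fun _ => y) →
      bracket X G w = fderiv ℝ (G.coord w) (chart w w) y := fun {X y} hX => by
    rw [bracket_apply, hX.lieBracket_vectorField_eq (Filter.EventuallyEq.refl _ _), lieBracket,
      fderiv_fun_const]
    exact sub_zero _
  have hJ : (JField (constVField w x)).coord w =ᶠ[𝓝 (chart w w)] fun _ => (0, x.1) := by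
    filter_upwards [eventuallyEq_coord_JField (constVField w x) w,
      eventuallyEq_coord_constVField w x] with z h1 h2
    rw [h1, h2]
  have h := hΓG w hw (constVField w x) (diffAt_constVField w x)
  rw [hlie hJ, hlie (eventuallyEq_coord_constVField w x), constVField_self, J_apply] at h
  exact h

theorem coordFun_one_add_sqLength_ne_zero {L : TM E M → ℝ} (hL : IsFinsler L) {w : TM E M}
    (hw : w ∈ slit E M) (ζ : PiField E M) : 1 + coordFun w (sqLength L ζ) (chart w w) ≠ 0 := by
  rw [coordFun_chart _ (mem_extChartAt_source w)]
  linarith [sqLength_nonneg hL hw ζ]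

/-- The factor `2E / (1 + p²)` in the shift of the canonical spray along `γζ`. -/
def shiftCoeff (L : TM E M → ℝ) (ζ : PiField E M) (w : TM E M) : ℝ :=
  2 * energy L w / (1 + sqLength L ζ w)

namespace IsConcurrent

variable {L : TM E M → ℝ} {ζ : PiField E M} {w : TM E M}

theorem differentiableAt_coordFun_shiftCoeff (hζ : IsConcurrent L ζ) (hL : IsFinsler L)
    (hw : w ∈ slit E M) : DifferentiableAt ℝ (coordFun w (shiftCoeff L ζ)) (chart w w) :=
  differentiableAt_div
    (((hL.contDiffAt_coordFun_energy_self hw 2).differentiableAt two_ne_zero).const_mul 2)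
    (((hζ.contDiffAt_coordFun_sqLength hL hw).differentiableAt two_ne_zero).const_add 1)
    (coordFun_one_add_sqLength_ne_zero hL hw ζ)

theorem vertDeriv_shiftCoeff (hζ : IsConcurrent L ζ) (hL : IsFinsler L) (hw : w ∈ slit E M)
    (a : E) : vertDeriv (coordFun w (shiftCoeff L ζ)) (chart w w) a =
      2 * vertDeriv (coordFun w (energy L)) (chart w w) a / (1 + sqLength L ζ w) := by
  have hq := (hL.contDiffAt_coordFun_energy_self hw 2).differentiableAt two_ne_zero
  have hP := (hζ.contDiffAt_coordFun_sqLength hL hw).differentiableAt two_ne_zero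
  have hPa : fderiv ℝ (fun z => 1 + coordFun w (sqLength L ζ) z) (chart w w) (0, a) = 0 := by
    rw [fderiv_const_add, (hζ.eventually_fderiv_sqLength hL hw).self_of_nhds, map_zero, mul_zero]
  have h := fderiv_div_apply_of_fderiv_eq_zero (hq.const_mul 2) (hP.const_add 1)
    (coordFun_one_add_sqLength_ne_zero hL hw ζ) hPa
  rw [fderiv_const_mul hq, coordFun_chart _ (mem_extChartAt_source w)] at h
  exact h

end IsConcurrent

namespace IsEnergyChange

variable {L L' : TM E M → ℝ} {ζ : PiField E M} {w : TM E M}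

theorem eventuallyEq_coordFun_energy (h : IsEnergyChange L L' ζ) (hw : w ∈ slit E M) :
    coordFun w (energy L') =ᶠ[𝓝 (chart w w)]
      fun z => coordFun w (energy L) z + coordFun w (pairing L ζ) z ^ 2 / 2 := by
  refine eventually_nhds_chart.2 ?_
  filter_upwards [eventually_mem_chart_source (mem_extChartAt_source w), slit_mem_nhds hw]
    with w' h' hw'
  rw [coordFun_chart _ h', coordFun_chart _ h', coordFun_chart _ h', energy, h w' hw', energy,
    pairing]
  ring

theorem ddJ_energy_add_smul_vertical (h : IsEnergyChange L L' ζ) (hζ : IsConcurrent L ζ)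
    (hL : IsFinsler L) {G : VField E M} (hG : IsCanonicalSpray L G) (hw : w ∈ slit E M)
    {k : ℝ} (hk : k * (1 + sqLength L ζ w) = 2 * energy L w) (x : E × E) :
    ddJ (coordFun w (energy L')) (chart w w)
        (G.coord w (chart w w) + k • (0, ζ.coord w (chart w w))) x =
      -fderiv ℝ (coordFun w (energy L')) (chart w w) x := by
  have hE := hL.contDiffAt_coordFun_energy_self hw 2
  have hB := hζ.contDiffAt_coordFun_pairing hL hw
  have hvB := (hζ.eventually_vertDeriv_pairing hL hw).self_of_nhds
  have hBζ : fderiv ℝ (coordFun w (pairing L ζ)) (chart w w) (0, ζ.coord w (chart w w)) =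
      sqLength L ζ w := (hvB _).trans (chartMetric_coord_self hL hw ζ)
  have hGy : (G.coord w (chart w w)).1 = (chart w w).2 := by
    obtain ⟨D, hD, -⟩ := hζ.2
    obtain ⟨s, -, hs⟩ := hG.exists_coord_eq_horizontal hL hD hw
    rw [hs]
  have hheq := h.eventuallyEq_coordFun_energy hw
  rw [ddJ_congr hheq, hheq.fderiv_eq, ddJ_add_sq_div_two hE hB, (hasFDerivAt_add_sq_div_two
    (hE.differentiableAt two_ne_zero) (hB.differentiableAt two_ne_zero)).fderiv,
    hζ.ddJ_pairing hL hw, ddJ_add_smul_left, ddJ_vertical, hG.ddJ_energy hL hw, map_add, map_smul,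
    hζ.fderiv_pairing_spray hL hG hw]
  rw [hBζ, hvB, hvB, coordFun_pairing_self hL hw, Prod.fst_add, Prod.smul_fst, hGy, smul_zero,
    add_zero, add_apply, smul_apply, smul_eq_mul, smul_eq_mul, ← chartMetric]
  linear_combination chartMetric L w (chart w w) (ζ.coord w (chart w w)) x.1 * hk

theorem spray_eq (h : IsEnergyChange L L' ζ) (hζ : IsConcurrent L ζ) (hL : IsFinsler L)
    (hL' : IsFinsler L') {G G' : VField E M} (hG : IsCanonicalSpray L G)
    (hG' : IsCanonicalSpray L' G') (hw : w ∈ slit E M) :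
    G' w = G w + shiftCoeff L ζ w • gam w (ζ w) := by
  have hpos : 1 + sqLength L ζ w ≠ 0 := by linarith [sqLength_nonneg hL hw ζ]
  have hcoord := hG'.coord_eq_of_ddJ_energy hL' hw
    (h.ddJ_energy_add_smul_vertical hζ hL hG hw (div_mul_cancel₀ _ hpos))
  rw [G'.coord_self, G.coord_self, ζ.coord_self, ← gam_apply w (ζ w)] at hcoord
  exact hcoord

theorem eventuallyEq_coord_spray (h : IsEnergyChange L L' ζ) (hζ : IsConcurrent L ζ)
    (hL : IsFinsler L) (hL' : IsFinsler L') {G G' : VField E M} (hG : IsCanonicalSpray L G)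
    (hG' : IsCanonicalSpray L' G') (hw : w ∈ slit E M) :
    G'.coord w =ᶠ[𝓝 (chart w w)] fun z => G.coord w z +
      (0, coordFun w (shiftCoeff L ζ) z • ζ.coord w z) := by
  refine eventually_nhds_chart.2 ?_
  filter_upwards [eventually_mem_chart_source (mem_extChartAt_source w), slit_mem_nhds hw]
    with w' h' hw'
  rw [G'.coord_chart h', h.spray_eq hζ hL hL' hG hG' hw', map_add, map_smul, chartDeriv_gam h',
    G.coord_chart h', ζ.coord_chart h', coordFun_chart _ h', Prod.smul_mk, smul_zero]

theorem barthel_apply (h : IsEnergyChange L L' ζ) (hζ : IsConcurrent L ζ) (hL : IsFinsler L)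
    (hL' : IsFinsler L') {Γ Γ' : ∀ w : TM E M, TTan w →L[ℝ] TTan w} (hΓ : IsBarthel L Γ)
    (hΓ' : IsBarthel L' Γ') (hw : w ∈ slit E M) (x : E × E) :
    Γ' w x = Γ w x + (2 * dJ (energy L) w x / (1 + sqLength L ζ w)) • gam w (ζ w) := by
  obtain ⟨G, hG, hΓG⟩ := hΓ.exists_spray_apply_eq
  obtain ⟨G', hG', hΓG'⟩ := hΓ'.exists_spray_apply_eq
  have hq := (hL.contDiffAt_coordFun_energy_self hw 2).differentiableAt two_ne_zero
  have hx := vertical_bracket_add_smul (VField.diffAt_iff.1 (hG.diffAt hw))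
    (hζ.differentiableAt_coordFun_shiftCoeff hL hw)
    (PiField.diffAt_iff.1 (hζ.diffAt hw)) (hζ.fderiv_coord_vertical hL hw) x
  rw [← (h.eventuallyEq_coord_spray hζ hL hL' hG hG' hw).fderiv_eq,
    hζ.vertDeriv_shiftCoeff hL hw, ← dJ_self hq, ζ.coord_self, ← gam_apply w (ζ w)] at hx
  exact (hΓG' w hw x).trans (hx.trans (congrArg (· + _) (hΓG w hw x).symm))

end IsEnergyChange

end Finsler

end

open Finsler in
theorem theorem2_general {E : Type*} [NormedAddCommGroup E] [NormedSpace ℝ E]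
    {M : Type*} [TopologicalSpace M] [ChartedSpace E M] [IsManifold 𝓘(ℝ, E) ∞ M]
    (L L' : TM E M → ℝ) (hL : IsFinsler L) (hL' : IsFinsler L')
    (ζ : PiField E M) (hζ : IsConcurrent L ζ) (hLL' : IsEnergyChange L L' ζ)
    (Γ Γ' : ∀ w : TM E M, TTan w →L[ℝ] TTan w) (hΓ : IsBarthel L Γ) (hΓ' : IsBarthel L' Γ') :
    ∀ w ∈ slit E M,
      Γ' w = Γ w + (2 : ℝ) • ((1 / (1 + metric L w (ζ w) (ζ w))) • dJ (energy L) w).smulRight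
        (gam w (ζ w)) ∧
      hProj Γ' w = hProj Γ w - changeForm L ζ w ∧
      vProj Γ' w = vProj Γ w + changeForm L ζ w := by
  intro w hw
  have hΓΓ' : Γ' w = Γ w + (2 : ℝ) • ((1 / (1 + metric L w (ζ w) (ζ w))) •
      dJ (energy L) w).smulRight (gam w (ζ w)) := by
    ext x
    refine (hLL'.barthel_apply hζ hL hL' hΓ hΓ' hw x).trans ?_
    simp only [add_apply, smul_apply, ContinuousLinearMap.smulRight_apply, smul_eq_mul, smul_smul,
      sqLength]
    congr 2
    ring
  refine ⟨hΓΓ', ?_, ?_⟩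
  · rw [hProj, hΓΓ', hProj, changeForm]
    module
  · rw [vProj, hΓΓ', vProj, changeForm]
    module

open Finsler in
theorem theorem2 {E : Type*} [NormedAddCommGroup E] [NormedSpace ℝ E] [FiniteDimensional ℝ E]
    {M : Type*} [TopologicalSpace M] [ChartedSpace E M] [IsManifold 𝓘(ℝ, E) ∞ M]
    [T2Space M] [ParacompactSpace M]
    (L L' : TM E M → ℝ) (hL : IsFinsler L) (hL' : IsFinsler L')
    (ζ : PiField E M) (hζ : IsConcurrent L ζ) (hLL' : IsEnergyChange L L' ζ)
    (Γ Γ' : ∀ w : TM E M, TTan w →L[ℝ] TTan w) (hΓ : IsBarthel L Γ) (hΓ' : IsBarthel L' Γ') :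
    ∀ w ∈ slit E M,
      Γ' w = Γ w + (2 : ℝ) • ((1 / (1 + metric L w (ζ w) (ζ w))) • dJ (energy L) w).smulRight
        (gam w (ζ w)) ∧
      hProj Γ' w = hProj Γ w - changeForm L ζ w ∧
      vProj Γ' w = vProj Γ w + changeForm L ζ w :=
  theorem2_general L L' hL hL' ζ hζ hLL' Γ Γ' hΓ hΓ'
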